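/- Let $\mathbb{K}$ be an algebraically closed field of characteristic different from $2$ and $3$. Let $G$ be the group with generators $g_a,g_b,g_c,g_d$ and relations $$g_ag_b=g_bg_c=g_cg_a,\quad g_ag_c=g_cg_d=g_dg_a,\quad g_ag_d=g_dg_b=g_bg_a,\quad g_bg_d=g_dg_c=g_cg_b$$ (the enveloping group of the tetrahedron rack). Let $B$ be the $\mathbb{K}$-algebra with generators $a,b,c,d$ and relations $$a^2=b^2=c^2=d^2=0,\qquad ab+bc+ca=ac+cd+da=ad+ba+db=bd+cb+dc=0,\qquad (a+b+c)^6=0,$$ graded by $\deg a=\deg b=\deg c=\deg d=1$ (the $72$-dimensional Nichols algebra of this rack with constant cocycle $-1$). For $\alpha_1,\alpha_2,\alpha_3\in\mathbb{K}$ let $\mathcal{T}(\alpha_1,\alpha_2,\alpha_3)$ be the $\mathbb{K}$-algebra with generators $a,b,c,d$ and relations $$a^2=b^2=c^2=d^2=\alpha_1,$$ $$ca+bc+ab=da+cd+ac=db+ba+ad=dc+cb+bd=\alpha_2,$$ $$(cb+ba+ac-\alpha_2)^3=\alpha_3,$$ filtered by degree in the generators. The group $G$ acts by algebra automorphisms on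 $B$ and on $\mathcal{T}(\alpha_1,\alpha_2,\alpha_3)$ by $$\begin{array}{c|cccc} & a&b&c&d\\ \hline g_a&-a&-c&-d&-b\\ g_b&-d&-b&-a&-c\\ g_c&-b&-d&-c&-a\\ g_d&-c&-a&-b&-d\end{array}$$ A PBW deformation of $B$ in the category of $G$-modules is a $\mathbb{K}$-algebra $D$ on which $G$ acts by algebra automorphisms, together with an exhaustive filtration $F_0\subseteq F_1\subseteq\cdots$ of $D$ by $G$-stable subspaces with $1\in F_0$ and $F_iF_j\subseteq F_{i+j}$, such that $\mathrm{gr}\,D=\bigoplus_{n\ge0}F_n/F_{n-1}$ (with $F_{-1}=0$) is isomorphic to $B$ as a graded algebra with $G$-action. **Theorem.** For every PBW deformation $D$ of $B$ in the category of $G$-modules there are $\alpha_1,\alpha_2,\alpha_3\in\mathbb{K}$ and a $G$-equivariant isomorphism of filtered algebras $\mathcal{T}(\alpha_1,\alpha_2,\alpha_3)\cong D$. -/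

import Mathlib

section Filtered

variable {K D : Type*} [Field K] [Ring D] [Algebra K D]

/-- The part `F_{n-1}` of a filtration indexed by `ℕ`: the supremum of all `F_m` with `m < n`
(so it is zero for `n = 0`). -/
def lowerPart (F : ℕ → Submodule K D) (n : ℕ) : Submodule K D := ⨆ m, ⨆ _ : m < n, F m

/-- The homogeneous component `F_n / F_{n-1}` of the associated graded algebra. -/
def GrPiece (F : ℕ → Submodule K D) (n : ℕ) : Type _ := ↥(F n) ⧸ (lowerPart F n).submoduleOf (F n)

namespace GrPiece

variable (F : ℕ → Submodule K D)

instance (n : ℕ) : AddCommGroup (GrPiece F n) :=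
  inferInstanceAs (AddCommGroup (↥(F n) ⧸ (lowerPart F n).submoduleOf (F n)))

instance (n : ℕ) : Module K (GrPiece F n) :=
  inferInstanceAs (Module K (↥(F n) ⧸ (lowerPart F n).submoduleOf (F n)))

/-- The class in `F_n / F_{n-1}` of an element of `F_n`. -/
def mk (n : ℕ) : ↥(F n) →ₗ[K] GrPiece F n := ((lowerPart F n).submoduleOf (F n)).mkQ

theorem mk_surjective (n : ℕ) : Function.Surjective (mk F n) := Submodule.mkQ_surjective _

theorem mk_eq_mk {n : ℕ} {x y : ↥(F n)} :
    mk F n x = mk F n y ↔ (x : D) - (y : D) ∈ lowerPart F n :=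
  Submodule.Quotient.eq _

theorem sigma_eq {i j : ℕ} (h : i = j) {x : ↥(F i)} {y : ↥(F j)} (e : (x : D) = y) :
    GradedMonoid.mk (A := GrPiece F) i (mk F i x) = GradedMonoid.mk j (mk F j y) := by
  subst h
  rw [Subtype.ext e]

variable [hF : IsRingFiltration F (lowerPart F)]

theorem lower_mul {i j : ℕ} {x y : D} (hx : x ∈ lowerPart F i) (hy : y ∈ F j) :
    x * y ∈ lowerPart F (i + j) := by
  have : lowerPart F i ≤ (lowerPart F (i + j)).comap (LinearMap.mulRight K y) := by
    refine iSup₂_le fun m hm z hz => ?_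
    exact hF.is_le (Nat.add_lt_add_right hm j) (SetLike.mul_mem_graded hz hy)
  exact this hx

theorem mul_lower {i j : ℕ} {x y : D} (hx : x ∈ F i) (hy : y ∈ lowerPart F j) :
    x * y ∈ lowerPart F (i + j) := by
  have : lowerPart F j ≤ (lowerPart F (i + j)).comap (LinearMap.mulLeft K x) := by
    refine iSup₂_le fun m hm z hz => ?_
    exact hF.is_le (Nat.add_lt_add_left hm i) (SetLike.mul_mem_graded hx hz)
  exact this hy

/-- The product `F_i / F_{i-1} × F_j / F_{j-1} → F_{i+j} / F_{i+j-1}` induced by that of `D`. -/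
def mul {i j : ℕ} : GrPiece F i → GrPiece F j → GrPiece F (i + j) :=
  Quotient.map₂ (fun x y => ⟨(x : D) * (y : D), SetLike.mul_mem_graded x.2 y.2⟩) <| by
    intro x x' hx y y' hy
    replace hx : (x : D) - x' ∈ lowerPart F i := 
      (Submodule.quotientRel_def ((lowerPart F i).submoduleOf (F i))).1 hx
    replace hy : (y : D) - y' ∈ lowerPart F j := 
      (Submodule.quotientRel_def ((lowerPart F j).submoduleOf (F j))).1 hy
    refine (Submodule.quotientRel_def ((lowerPart F (i + j)).submoduleOf (F (i + j)))).2 ?_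
    have e : (x : D) * y - x' * y' = (x - x') * y + x' * (y - y') := by
      rw [sub_mul, mul_sub]; abel
    change (x : D) * y - x' * y' ∈ lowerPart F (i + j)
    rw [e]
    exact add_mem (lower_mul F hx y.2) (mul_lower F x'.2 hy)

theorem mul_mk {i j : ℕ} (x : ↥(F i)) (y : ↥(F j)) :
    mul F (mk F i x) (mk F j y) = mk F (i + j) ⟨(x : D) * (y : D), SetLike.mul_mem_graded x.2 y.2⟩ :=
  rfl

instance : GradedMonoid.GMul (GrPiece F) := ⟨mul F⟩

instance : GradedMonoid.GOne (GrPiece F) := ⟨mk F 0 ⟨1, SetLike.one_mem_graded F⟩⟩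

instance : DirectSum.GSemiring (GrPiece F) where
  natCast n := mk F 0 (n • ⟨1, SetLike.one_mem_graded F⟩)
  natCast_zero := by rw [zero_smul, map_zero]
  natCast_succ n := by rw [succ_nsmul, map_add]; rfl
  mul_zero {i j} x := by
    obtain ⟨x, rfl⟩ := mk_surjective F i x
    refine Eq.trans (congrArg (mul F _) (map_zero (mk F j)).symm) ?_
    refine Eq.trans (congrArg (mk F (i + j)) ?_) (map_zero (mk F (i + j)))
    ext; simp
  zero_mul {i j} y := by
    obtain ⟨y, rfl⟩ := mk_surjective F j y
    refine Eq.trans (congrArg (fun z => mul F z _) (map_zero (mk F i)).symm) ?_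
    refine Eq.trans (congrArg (mk F (i + j)) ?_) (map_zero (mk F (i + j)))
    ext; simp
  mul_add {i j} x y z := by
    obtain ⟨x, rfl⟩ := mk_surjective F i x
    obtain ⟨y, rfl⟩ := mk_surjective F j y
    obtain ⟨z, rfl⟩ := mk_surjective F j z
    rw [← map_add]
    exact (congrArg (mk F (i + j)) (Subtype.ext (mul_add (x : D) y z))).trans (map_add _ _ _)
  add_mul {i j} x y z := by
    obtain ⟨x, rfl⟩ := mk_surjective F i x
    obtain ⟨y, rfl⟩ := mk_surjective F i y
    obtain ⟨z, rfl⟩ := mk_surjective F j z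
    rw [← map_add]
    exact (congrArg (mk F (i + j)) (Subtype.ext (add_mul (x : D) y z))).trans (map_add _ _ _)
  one_mul := by
    rintro ⟨i, x⟩
    obtain ⟨x, rfl⟩ := mk_surjective F i x
    exact sigma_eq F (zero_add i) (one_mul (x : D))
  mul_one := by
    rintro ⟨i, x⟩
    obtain ⟨x, rfl⟩ := mk_surjective F i x
    exact sigma_eq F (add_zero i) (mul_one (x : D))
  mul_assoc := by
    rintro ⟨i, x⟩ ⟨j, y⟩ ⟨k, z⟩
    obtain ⟨x, rfl⟩ := mk_surjective F i x
    obtain ⟨y, rfl⟩ := mk_surjective F j y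
    obtain ⟨z, rfl⟩ := mk_surjective F k z
    exact sigma_eq F (add_assoc i j k) (mul_assoc (x : D) y z)

theorem algebraMap_mem_zero (r : K) : algebraMap K D r ∈ F 0 := by
  rw [Algebra.algebraMap_eq_smul_one]
  exact (F 0).smul_mem r (SetLike.one_mem_graded F)

instance : DirectSum.GAlgebra K (GrPiece F) where
  toFun := (mk F 0).toAddMonoidHom.comp
    { toFun := fun r => ⟨algebraMap K D r, algebraMap_mem_zero F r⟩
      map_zero' := by ext; simp
      map_add' := fun r s => by ext; simp }
  map_one := by
    refine congrArg (mk F 0) ?_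
    ext; exact map_one _
  map_mul r s := sigma_eq F (zero_add 0).symm (map_mul (algebraMap K D) r s)
  commutes := by
    rintro r ⟨i, x⟩
    obtain ⟨x, rfl⟩ := mk_surjective F i x
    exact sigma_eq F (add_comm 0 i) (Algebra.commutes r (x : D))
  smul_def := by
    rintro r ⟨i, x⟩
    obtain ⟨x, rfl⟩ := mk_surjective F i x
    exact sigma_eq F (zero_add i).symm (Algebra.smul_def r (x : D))

end GrPiece

end Filtered

open scoped DirectSum

section Deformations

variable (K G : Type*) [Field K] [Group G]

/-- An `ℕ`-filtered algebra in the category of `G`-modules over `K`: an algebra `D` on which `G`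
acts by `K`-algebra automorphisms, with an exhaustive filtration `F_0 ⊆ F_1 ⊆ ⋯` by
`G`-stable subspaces such that `1 ∈ F_0` and `F_i F_j ⊆ F_{i+j}`. -/
structure FilteredGAlgebra (D : Type*) [Ring D] [Algebra K D] where
  /-- the action of `G` -/
  act : G →* (D ≃ₐ[K] D)
  /-- the filtration -/
  fil : ℕ → Submodule K D
  isRingFiltration : IsRingFiltration fil (lowerPart fil)
  exhaustive : ∀ x : D, ∃ n, x ∈ fil n
  stable : ∀ (g : G) (n : ℕ), ∀ x ∈ fil n, act g x ∈ fil n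

namespace FilteredGAlgebra

variable {K G} {D : Type*} [Ring D] [Algebra K D] (𝓓 : FilteredGAlgebra K G D)

instance : IsRingFiltration 𝓓.fil (lowerPart 𝓓.fil) := 𝓓.isRingFiltration

/-- The associated graded algebra `gr D = ⨁ n, F_n / F_{n-1}`. -/
abbrev Gr : Type _ := ⨁ n, GrPiece 𝓓.fil n

theorem stable_lower (g : G) (n : ℕ) : ∀ x ∈ lowerPart 𝓓.fil n, 𝓓.act g x ∈ lowerPart 𝓓.fil n := by
  have : lowerPart 𝓓.fil n ≤ (lowerPart 𝓓.fil n).comap (𝓓.act g).toLinearMap :=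
    iSup₂_le fun m hm x hx => 𝓓.isRingFiltration.is_le hm (𝓓.stable g m x hx)
  exact this

/-- The action of `g` on `F_n / F_{n-1}`, sending the class of `x` to the class of `g • x`. -/
def grPieceAct (g : G) (n : ℕ) : GrPiece 𝓓.fil n →ₗ[K] GrPiece 𝓓.fil n :=
  Submodule.mapQ _ _ ((𝓓.act g).toLinearMap.restrict (𝓓.stable g n))
    fun x hx => 𝓓.stable_lower g n x hx

theorem grPieceAct_mk (g : G) (n : ℕ) (x : ↥(𝓓.fil n)) :
    𝓓.grPieceAct g n (GrPiece.mk 𝓓.fil n x) =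
      GrPiece.mk 𝓓.fil n ⟨𝓓.act g x, 𝓓.stable g n x x.2⟩ := rfl

/-- The action of `g` on `gr D`. -/
def grAct (g : G) : 𝓓.Gr →ₗ[K] 𝓓.Gr := DirectSum.lmap (𝓓.grPieceAct g)

end FilteredGAlgebra

variable {K G}

/-- Let `A = ⨁ n, 𝒜 n` be a graded algebra with an action `ρ` of `G` by algebra automorphisms. A
filtered algebra `D` in the category of `G`-modules is a PBW deformation of `A` if `gr D` and `A`
are isomorphic as graded algebras in the category of `G`-modules. -/
def IsPBWDeformation {A : Type*} [Ring A] [Algebra K A] (𝒜 : ℕ → Submodule K A) [GradedAlgebra 𝒜]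
    (ρ : G →* (A ≃ₐ[K] A)) {D : Type*} [Ring D] [Algebra K D] (𝓓 : FilteredGAlgebra K G D) : Prop :=
  ∃ ψ : 𝓓.Gr ≃ₐ[K] A,
    (∀ n, (LinearMap.range (DirectSum.lof K ℕ (GrPiece 𝓓.fil) n)).map ψ.toLinearMap = 𝒜 n) ∧
    ∀ (g : G) (z : 𝓓.Gr), ψ (𝓓.grAct g z) = ρ g (ψ z)

end Deformations

namespace Tetrahedron

/-! The indices `0, 1, 2, 3` stand for `a, b, c, d`. -/

/-- The rack operation `i ▷ j`; the row of `i` lists `i ▷ a, i ▷ b, i ▷ c, i ▷ d`. -/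
def op : Fin 4 → Fin 4 → Fin 4 := ![![0, 2, 3, 1], ![3, 1, 0, 2], ![1, 3, 2, 0], ![2, 0, 1, 3]]

/-- The relators `x y⁻¹` of the defining relations `x = y` of the enveloping group:
`g_a g_b = g_b g_c = g_c g_a`, `g_a g_c = g_c g_d = g_d g_a`, `g_a g_d = g_d g_b = g_b g_a`,
`g_b g_d = g_d g_c = g_c g_b`. -/
def groupRels : Set (FreeGroup (Fin 4)) :=
  let ga := FreeGroup.of (0 : Fin 4)
  let gb := FreeGroup.of (1 : Fin 4)
  let gc := FreeGroup.of (2 : Fin 4)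
  let gd := FreeGroup.of (3 : Fin 4)
  {(ga * gb) * (gb * gc)⁻¹, (gb * gc) * (gc * ga)⁻¹,
   (ga * gc) * (gc * gd)⁻¹, (gc * gd) * (gd * ga)⁻¹,
   (ga * gd) * (gd * gb)⁻¹, (gd * gb) * (gb * ga)⁻¹,
   (gb * gd) * (gd * gc)⁻¹, (gd * gc) * (gc * gb)⁻¹}

/-- The group `G` generated by `g_a, g_b, g_c, g_d` with the relations above. -/
abbrev EnvGroup : Type := PresentedGroup groupRels

section Identities

variable {K A : Type*} [Field K] [Ring A] [Algebra K A]

theorem braid_aux (p q : K) (a b c : A)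
   (ha : a * a = p • 1) (hb : b * b = p • 1)
   (h1 : c * a + b * c + a * b = q • 1) : b * (a * b) - a * (b * a) = q • b - q • a := by
  have e : b * (c * a + b * c + a * b) - (c * a + b * c + a * b) * a = q • b - q • a := by
    rw [h1]; simp
  have ta : ∀ z, a * (a * z) = p • z := fun z => by rw [← mul_assoc, ha, smul_mul_assoc, one_mul]
  have tb : ∀ z, b * (b * z) = p • z := fun z => by rw [← mul_assoc, hb, smul_mul_assoc, one_mul]
  rw [← e]
  simp only [mul_assoc, mul_add, add_mul, ha, tb, mul_smul_comm, mul_one]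
  abel

theorem skew_aux (p q : K) (a b c : A)
   (ha : a * a = p • 1) (hb : b * b = p • 1)
   (h1 : c * a + b * c + a * b = q • 1) :
   (c * b + b * a + a * c - q • 1) * b = a * (c * b + b * a + a * c - q • 1) := by
  have ta : ∀ z, a * (a * z) = p • z := fun z => by rw [← mul_assoc, ha, smul_mul_assoc, one_mul]
  have e := eq_add_of_sub_eq (braid_aux p q a b c ha hb h1)
  simp only [mul_assoc, mul_add, add_mul, sub_mul, mul_sub, hb, ta, mul_smul_comm, smul_mul_assoc,
    one_mul, mul_one, e]
  module

theorem comm_aux (p q : K) (a b c d : A)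
   (ha : a * a = p • 1) (hb : b * b = p • 1) (hc : c * c = p • 1)
   (h2 : d * a = q • 1 - a * c - c * d)
   (h3 : d * b = q • 1 - b * a - a * d) (h4 : d * c = q • 1 - c * b - b * d) :
   d * (c * b + b * a + a * c - q • 1) = (c * b + b * a + a * c - q • 1) * d := by
  have t : ∀ {x y w : A}, x * y = w → ∀ z, x * (y * z) = w * z :=
    fun h z => by rw [← h, mul_assoc]
  simp only [mul_assoc, mul_add, add_mul, sub_mul, mul_sub, ha, hb, hc, t ha, t hb, t hc,
    h2, h3, h4, t h2, t h3, t h4, mul_smul_comm, smul_mul_assoc, one_mul, mul_one]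
  module

theorem sq_core (p q : K) (a u c d y : A)
    (ha : a * a = p • 1) (hc : c * c = p • 1) (hd : d * d = p • 1)
    (uuu : u * (u * u) = (3 * p - q) • u)
    (rau : a * u = - (u * a) - u * u)
    (rca : c * a = q • 1 - p • 1 + u * a + u * u - u * c - a * c)
    (rcu : c * u = y - (2:K) • (u * a) - u * u + u * c)
    (rda : d * a = q • 1 - a * c - c * d)
    (rdu : d * u = - (u * a) - p • 1 - a * d + a * c + c * d)
    (rdc : d * c = q • 1 - c * u - c * a - u * d - a * d)
    (ya : y * a = c * y) (yc : y * c = a * y + u * y) (ryu : y * u = a * y - c * y)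
    (yd : d * y = y * d) :
    (- (u * d) - c * u) * (- (u * d) - c * u) =
      (a * d - c * d - a * c + p • 1 - u * a - u * u + u * d) * y := by
  have t : ∀ {x y w : A}, x * y = w → ∀ z, x * (y * z) = w * z :=
    fun h z => by rw [← h, mul_assoc]
  have uuut : ∀ z, u * (u * (u * z)) = (3 * p - q) • (u * z) := fun z => by
    rw [← mul_assoc u u z, ← mul_assoc u _ z, uuu, smul_mul_assoc]
  simp only [mul_assoc, mul_add, add_mul, sub_mul, mul_sub, mul_neg, neg_mul, ha, hc, hd, t ha,
    t hc, rau, rca, rcu, rda, rdu, rdc, ya, yc, ryu, yd, t rau, t rca, t rcu, t rdu, t ryu, uuu, uuut, mul_smul_comm, smul_mul_assoc, one_mul, mul_one]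
  module

theorem sq_aux (p q : K) (a b c d : A)
   (ha : a * a = p • 1) (hb : b * b = p • 1) (hc : c * c = p • 1) (hd : d * d = p • 1)
   (h1 : c * a + b * c + a * b = q • 1) (h2 : d * a + c * d + a * c = q • 1)
   (h3 : d * b + b * a + a * d = q • 1) (h4 : d * c + c * b + b * d = q • 1) :
   (a * d + d * c + c * a - q • 1) * (a * d + d * c + c * a - q • 1) =
     (d * a + a * b + b * d - q • 1) * (c * b + b * a + a * c - q • 1) := by
  have red : ∀ {x x' z z' : A}, x = x' → z - z' = x - x' → z = z' := by
    intro x x' z z' h e; rw [h, sub_self] at e; exact sub_eq_zero.1 e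
  have t : ∀ {x y w : A}, x * y = w → ∀ z, x * (y * z) = w * z :=
    fun h z => by rw [← h, mul_assoc]
  have yd := comm_aux p q a b c d ha hb hc (red h2 (by module)) (red h3 (by module))
    (red h4 (by module))
  have yb := skew_aux p q a b c ha hb h1
  have yc := skew_aux p q b c a hb hc (red h1 (by module))
  have ya := skew_aux p q c a b hc ha (red h1 (by module))
  rw [show a * c + c * b + b * a = c * b + b * a + a * c by abel] at yc
  rw [show b * a + a * c + c * b = c * b + b * a + a * c by abel] at ya
  have br := eq_add_of_sub_eq (braid_aux p q a b c ha hb h1)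
  have uuu : (b - a) * ((b - a) * (b - a)) = (3 * p - q) • (b - a) := by
    simp only [mul_sub, sub_mul, ha, hb, br, mul_smul_comm, mul_one]
    rw [← mul_assoc a a b, ← mul_assoc b b a, ha, hb]
    simp only [smul_mul_assoc, one_mul]
    module
  have rau : a * (b - a) = - ((b - a) * a) - (b - a) * (b - a) := by
    simp only [mul_sub, sub_mul, ha, hb]
    module
  have rca : c * a = q • 1 - a * b - b * c := red h1 (by module)
  have rda : d * a = q • 1 - a * c - c * d := red h2 (by module)
  have rdb : d * b = q • 1 - b * a - a * d := red h3 (by module)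
  have rdc : d * c = q • 1 - c * b - b * d := red h4 (by module)
  have key := sq_core p q a (b - a) c d (c * b + b * a + a * c - q • 1) ha hc hd uuu rau
    (by simp only [mul_sub, sub_mul, ha, hb, rca]; module)
    (by simp only [mul_sub, sub_mul, ha, hb, rca]; module)
    rda
    (by simp only [mul_sub, sub_mul, ha, rda, rdb]; module)
    (by simp only [mul_sub, sub_mul, rdc]; module)
    ya (by rw [yc, ← add_mul]; congr 1; abel) (by rw [mul_sub, yb, ya]) yd
  have e1 : a * d + d * c + c * a - q • 1 = - ((b - a) * d) - c * (b - a) := by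
    rw [rdc]
    simp only [mul_sub, sub_mul]
    module
  rw [e1, key, rda]
  congr 1
  simp only [mul_sub, sub_mul, ha, hb]
  module

/-- The eight quadratic relations. -/
structure QuadRel {K A : Type*} [Field K] [Semiring A] [Algebra K A] (p q : K) (a b c d : A) :
    Prop where
  aa : a * a = algebraMap K A p
  bb : b * b = algebraMap K A p
  cc : c * c = algebraMap K A p
  dd : d * d = algebraMap K A p
  abc : c * a + b * c + a * b = algebraMap K A q
  acd : d * a + c * d + a * c = algebraMap K A q
  adb : d * b + b * a + a * d = algebraMap K A q
  bdc : d * c + c * b + b * d = algebraMap K A q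

namespace QuadRel

variable {p q : K} {a b c d : A}

theorem rotA (h : QuadRel p q a b c d) : QuadRel p q a c d b where
  aa := h.aa
  bb := h.cc
  cc := h.dd
  dd := h.bb
  abc := by rw [← h.acd]
  acd := by rw [← h.adb]; abel
  adb := by rw [← h.abc]; abel
  bdc := by rw [← h.bdc]; abel

theorem rotB (h : QuadRel p q a b c d) : QuadRel p q d b a c where
  aa := h.dd
  bb := h.bb
  cc := h.aa
  dd := h.cc
  abc := by rw [← h.adb]; abel
  acd := by rw [← h.acd]; abel
  adb := by rw [← h.bdc]; abel
  bdc := by rw [← h.abc]; abel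

theorem rotC (h : QuadRel p q a b c d) : QuadRel p q b d c a where
  aa := h.bb
  bb := h.dd
  cc := h.cc
  dd := h.aa
  abc := by rw [← h.bdc]; abel
  acd := by rw [← h.abc]; abel
  adb := by rw [← h.adb]; abel
  bdc := by rw [← h.acd]; abel

theorem rotD (h : QuadRel p q a b c d) : QuadRel p q c a b d where
  aa := h.cc
  bb := h.aa
  cc := h.bb
  dd := h.dd
  abc := by rw [← h.abc]; abel
  acd := by rw [← h.bdc]; abel
  adb := by rw [← h.acd]; abel
  bdc := by rw [← h.adb]

theorem neg (h : QuadRel p q a b c d) : QuadRel p q (-a) (-b) (-c) (-d) where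
  aa := by rw [neg_mul_neg, h.aa]
  bb := by rw [neg_mul_neg, h.bb]
  cc := by rw [neg_mul_neg, h.cc]
  dd := by rw [neg_mul_neg, h.dd]
  abc := by simp only [neg_mul_neg, h.abc]
  acd := by simp only [neg_mul_neg, h.acd]
  adb := by simp only [neg_mul_neg, h.adb]
  bdc := by simp only [neg_mul_neg, h.bdc]

theorem sq (h : QuadRel p q a b c d) :
    (a * d + d * c + c * a - algebraMap K A q) * (a * d + d * c + c * a - algebraMap K A q) =
      (d * a + a * b + b * d - algebraMap K A q) * (c * b + b * a + a * c - algebraMap K A q) := by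
  obtain ⟨h1, h2, h3, h4, h5, h6, h7, h8⟩ := h
  simp only [Algebra.algebraMap_eq_smul_one] at *
  exact sq_aux p q a b c d h1 h2 h3 h4 h5 h6 h7 h8

theorem cube_ab (h : QuadRel p q a b c d) :
    (a * d + d * c + c * a - algebraMap K A q) ^ 3 =
      (b * c + c * d + d * b - algebraMap K A q) ^ 3 := by
  have e1 := h.rotB.rotB.sq
  have e2 := h.rotD.sq
  rw [show c * a + a * d + d * c = a * d + d * c + c * a by abel,
    show a * c + c * b + b * a = c * b + b * a + a * c by abel,
    show d * b + b * c + c * d = b * c + c * d + d * b by abel] at e1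
  rw [show c * d + d * b + b * c = b * c + c * d + d * b by abel,
    show d * c + c * a + a * d = a * d + d * c + c * a by abel,
    show b * a + a * c + c * b = c * b + b * a + a * c by abel] at e2
  rw [pow_succ', pow_two, e1, ← mul_assoc, ← e2, pow_succ, pow_two]

theorem cube_ad (h : QuadRel p q a b c d) :
    (c * b + b * a + a * c - algebraMap K A q) ^ 3 =
      (b * c + c * d + d * b - algebraMap K A q) ^ 3 := by
  have e := h.rotA.rotA.cube_ab
  rw [show a * c + c * b + b * a = c * b + b * a + a * c by abel,
    show d * b + b * c + c * d = b * c + c * d + d * b by abel] at e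
  exact e

theorem cube_ac (h : QuadRel p q a b c d) :
    (d * a + a * b + b * d - algebraMap K A q) ^ 3 =
      (b * c + c * d + d * b - algebraMap K A q) ^ 3 := by
  have e := h.rotA.cube_ab
  rw [show a * b + b * d + d * a = d * a + a * b + b * d by abel,
    show c * d + d * b + b * c = b * c + c * d + d * b by abel] at e
  exact e

theorem pow_six (h : QuadRel (0 : K) 0 a b c d) :
    (a + b + c) ^ 6 = (c * b + b * a + a * c - algebraMap K A 0) ^ 3 := by
  have e : (a + b + c) ^ 2 = c * b + b * a + a * c - algebraMap K A 0 := by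
    have e1 : (a + b + c) ^ 2 = a * a + b * b + c * c + (c * a + b * c + a * b)
        + (c * b + b * a + a * c) := by
      rw [pow_two]; simp only [mul_add, add_mul]; abel
    rw [e1, h.aa, h.bb, h.cc, h.abc]; simp
  rw [← e, ← pow_mul]

end QuadRel

section Act

variable {p q : K} {x : Fin 4 → A}

theorem QuadRel.act (h : QuadRel p q (x 0) (x 1) (x 2) (x 3)) (i : Fin 4) :
    QuadRel p q (-x (op i 0)) (-x (op i 1)) (-x (op i 2)) (-x (op i 3)) := by
  fin_cases i
  exacts [h.rotA.neg, h.rotB.neg, h.rotC.neg, h.rotD.neg]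

theorem QuadRel.cube_act (h : QuadRel p q (x 0) (x 1) (x 2) (x 3)) (i : Fin 4) :
    ((-x (op i 2)) * (-x (op i 1)) + (-x (op i 1)) * (-x (op i 0)) + (-x (op i 0)) * (-x (op i 2))
      - algebraMap K A q) ^ 3 =
    (x 2 * x 1 + x 1 * x 0 + x 0 * x 2 - algebraMap K A q) ^ 3 := by
  simp only [neg_mul_neg]
  rw [h.cube_ad]
  fin_cases i
  · refine Eq.trans ?_ h.cube_ab
    change (x 3 * x 2 + x 2 * x 0 + x 0 * x 3 - _) ^ 3 = _
    congr 2; abel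
  · refine Eq.trans ?_ h.cube_ac
    change (x 0 * x 1 + x 1 * x 3 + x 3 * x 0 - _) ^ 3 = _
    congr 2; abel
  · change (x 2 * x 3 + x 3 * x 1 + x 1 * x 2 - _) ^ 3 = _
    congr 2; abel
  · refine Eq.trans ?_ h.cube_ad
    change (x 1 * x 0 + x 0 * x 2 + x 2 * x 1 - _) ^ 3 = _
    congr 2; abel

/-- An action of `EnvGroup` by algebra automorphisms, from endomorphisms `f i` that act on
generators `x j` of the algebra by `f i (x j) = - x (i ▷ j)`. -/
def groupAct (hx : Algebra.adjoin K (Set.range x) = ⊤) (f : Fin 4 → A →ₐ[K] A)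
    (hf : ∀ i j, f i (x j) = - x (op i j)) : EnvGroup →* (A ≃ₐ[K] A) :=
  have h6 : ∀ i, f i ^ 6 = 1 := fun i => AlgHom.ext_of_adjoin_eq_top hx <| by
    rintro _ ⟨j, rfl⟩
    have : op i (op i (op i (op i (op i (op i j))))) = j := by revert i j; decide
    simp only [pow_succ, pow_zero, one_mul, AlgHom.mul_apply, hf, map_neg, neg_neg,
      this, AlgHom.one_apply]
  PresentedGroup.toGroup
    (f := fun i => AlgEquiv.algHomUnitsEquiv K A (Units.ofPowEqOne (f i) 6 (h6 i) (by norm_num))) <| by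
    have key : ∀ i j k l : Fin 4, (∀ m, op i (op j m) = op k (op l m)) →
        AlgEquiv.algHomUnitsEquiv K A (Units.ofPowEqOne (f i) 6 (h6 i) (by norm_num)) *
        AlgEquiv.algHomUnitsEquiv K A (Units.ofPowEqOne (f j) 6 (h6 j) (by norm_num)) =
        AlgEquiv.algHomUnitsEquiv K A (Units.ofPowEqOne (f k) 6 (h6 k) (by norm_num)) *
        AlgEquiv.algHomUnitsEquiv K A (Units.ofPowEqOne (f l) 6 (h6 l) (by norm_num)) := by
      intro i j k l h
      have e : (f i).comp (f j) = (f k).comp (f l) := AlgHom.ext_of_adjoin_eq_top hx <| by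
        rintro _ ⟨m, rfl⟩
        simp only [AlgHom.comp_apply, hf, map_neg, h]
      exact AlgEquiv.ext fun z => DFunLike.congr_fun e z
    intro r hr
    simp only [groupRels, Set.mem_insert_iff, Set.mem_singleton_iff] at hr
    rcases hr with rfl | rfl | rfl | rfl | rfl | rfl | rfl | rfl <;>
    · simp only [map_mul, map_inv, FreeGroup.lift_apply_of]
      rw [← map_mul, ← map_mul, mul_inv_eq_one, map_mul, map_mul]
      exact key _ _ _ _ (by decide)

theorem groupAct_of (hx : Algebra.adjoin K (Set.range x) = ⊤) (f : Fin 4 → A →ₐ[K] A)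
    (hf : ∀ i j, f i (x j) = - x (op i j)) (i j : Fin 4) :
    groupAct hx f hf (PresentedGroup.of i) (x j) = - x (op i j) := by
  rw [groupAct, PresentedGroup.toGroup.of]
  exact hf i j

end Act

end Identities

section Algebras

variable (K : Type*) [Field K]

/-- The free generator `a`. -/
abbrev fa : FreeAlgebra K (Fin 4) := FreeAlgebra.ι K 0
/-- The free generator `b`. -/
abbrev fb : FreeAlgebra K (Fin 4) := FreeAlgebra.ι K 1
/-- The free generator `c`. -/
abbrev fc : FreeAlgebra K (Fin 4) := FreeAlgebra.ι K 2
/-- The free generator `d`. -/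
abbrev fd : FreeAlgebra K (Fin 4) := FreeAlgebra.ι K 3

/-- The defining relations of the Nichols algebra `B`. -/
inductive NicholsRel : FreeAlgebra K (Fin 4) → FreeAlgebra K (Fin 4) → Prop
  | aa : NicholsRel (fa K * fa K) 0
  | bb : NicholsRel (fb K * fb K) 0
  | cc : NicholsRel (fc K * fc K) 0
  | dd : NicholsRel (fd K * fd K) 0
  | abc : NicholsRel (fa K * fb K + fb K * fc K + fc K * fa K) 0
  | acd : NicholsRel (fa K * fc K + fc K * fd K + fd K * fa K) 0
  | adb : NicholsRel (fa K * fd K + fb K * fa K + fd K * fb K) 0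
  | bdc : NicholsRel (fb K * fd K + fc K * fb K + fd K * fc K) 0
  | six : NicholsRel ((fa K + fb K + fc K) ^ 6) 0

/-- The `72`-dimensional Nichols algebra `B` of the tetrahedron rack with constant cocycle `-1`,
by generators and relations. -/
abbrev Nichols : Type _ := RingQuot (NicholsRel K)

variable {K}

/-- The defining relations of `T(α₁, α₂, α₃)`. -/
inductive DefRel (α₁ α₂ α₃ : K) : FreeAlgebra K (Fin 4) → FreeAlgebra K (Fin 4) → Prop
  | aa : DefRel α₁ α₂ α₃ (fa K * fa K) (algebraMap K _ α₁)
  | bb : DefRel α₁ α₂ α₃ (fb K * fb K) (algebraMap K _ α₁)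
  | cc : DefRel α₁ α₂ α₃ (fc K * fc K) (algebraMap K _ α₁)
  | dd : DefRel α₁ α₂ α₃ (fd K * fd K) (algebraMap K _ α₁)
  | abc : DefRel α₁ α₂ α₃ (fc K * fa K + fb K * fc K + fa K * fb K) (algebraMap K _ α₂)
  | acd : DefRel α₁ α₂ α₃ (fd K * fa K + fc K * fd K + fa K * fc K) (algebraMap K _ α₂)
  | adb : DefRel α₁ α₂ α₃ (fd K * fb K + fb K * fa K + fa K * fd K) (algebraMap K _ α₂)
  | bdc : DefRel α₁ α₂ α₃ (fd K * fc K + fc K * fb K + fb K * fd K) (algebraMap K _ α₂)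
  | cube : DefRel α₁ α₂ α₃
      ((fc K * fb K + fb K * fa K + fa K * fc K - algebraMap K _ α₂) ^ 3) (algebraMap K _ α₃)

/-- The algebra `T(α₁, α₂, α₃)`. -/
abbrev DefAlg (α₁ α₂ α₃ : K) : Type _ := RingQuot (DefRel α₁ α₂ α₃)

theorem adjoin_quot (r : FreeAlgebra K (Fin 4) → FreeAlgebra K (Fin 4) → Prop) :
    Algebra.adjoin K (Set.range fun i => RingQuot.mkAlgHom K r (FreeAlgebra.ι K i)) = ⊤ := by
  have := congrArg (Subalgebra.map (RingQuot.mkAlgHom K r)) (FreeAlgebra.adjoin_range_ι K (Fin 4))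
  rw [AlgHom.map_adjoin, ← Set.range_comp, Algebra.map_top,
    (AlgHom.range_eq_top _).2 (RingQuot.mkAlgHom_surjective K r)] at this
  exact this

namespace DefAlg

variable (α₁ α₂ α₃ : K)

/-- The generators of `T(α₁, α₂, α₃)`. -/
def gen (i : Fin 4) : DefAlg α₁ α₂ α₃ := RingQuot.mkAlgHom K _ (FreeAlgebra.ι K i)

theorem adjoin_gen : Algebra.adjoin K (Set.range (gen α₁ α₂ α₃)) = ⊤ := adjoin_quot _

theorem quadRel :
    QuadRel α₁ α₂ (gen α₁ α₂ α₃ 0) (gen α₁ α₂ α₃ 1) (gen α₁ α₂ α₃ 2) (gen α₁ α₂ α₃ 3) := by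
  constructor <;> simp only [gen, ← map_mul, ← map_add] <;>
    rw [← AlgHom.commutes (RingQuot.mkAlgHom K (DefRel α₁ α₂ α₃))] <;>
    exact RingQuot.mkAlgHom_rel K (by constructor)

theorem cube : (gen α₁ α₂ α₃ 2 * gen α₁ α₂ α₃ 1 + gen α₁ α₂ α₃ 1 * gen α₁ α₂ α₃ 0 +
    gen α₁ α₂ α₃ 0 * gen α₁ α₂ α₃ 2 - algebraMap K _ α₂) ^ 3 = algebraMap K _ α₃ := by
  have := RingQuot.mkAlgHom_rel K (DefRel.cube (α₁ := α₁) (α₂ := α₂) (α₃ := α₃))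
  simpa only [map_pow, map_sub, map_add, map_mul, AlgHom.commutes, gen] using this

/-- The endomorphism of `T(α₁, α₂, α₃)` given by the action of `g_i`: it sends the generator `x_j`
to `-x_{i ▷ j}`. -/
def genAct (i : Fin 4) : DefAlg α₁ α₂ α₃ →ₐ[K] DefAlg α₁ α₂ α₃ :=
  RingQuot.liftAlgHom K ⟨FreeAlgebra.lift K fun j => - gen α₁ α₂ α₃ (op i j), by
    have h := (quadRel α₁ α₂ α₃).act i
    have h6 := (quadRel α₁ α₂ α₃).cube_act i
    rw [cube] at h6
    intro x y hxy
    cases hxy <;> simp only [map_pow, map_sub, map_add, map_mul, AlgHom.commutes,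
      FreeAlgebra.lift_ι_apply]
    exacts [h.aa, h.bb, h.cc, h.dd, h.abc, h.acd, h.adb, h.bdc, h6]⟩

theorem genAct_gen (i j : Fin 4) :
    genAct α₁ α₂ α₃ i (gen α₁ α₂ α₃ j) = - gen α₁ α₂ α₃ (op i j) := by
  rw [genAct, gen, RingQuot.liftAlgHom_mkAlgHom_apply, FreeAlgebra.lift_ι_apply]

/-- The action of `G` on `T(α₁, α₂, α₃)` by algebra automorphisms:
`g_i` sends the generator `x_j` to `-x_{i ▷ j}`. -/
def act : EnvGroup →* (DefAlg α₁ α₂ α₃ ≃ₐ[K] DefAlg α₁ α₂ α₃) :=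
  groupAct (adjoin_gen α₁ α₂ α₃) (genAct α₁ α₂ α₃) (genAct_gen α₁ α₂ α₃)

theorem act_of_gen (i j : Fin 4) :
    act α₁ α₂ α₃ (PresentedGroup.of i) (gen α₁ α₂ α₃ j) = - gen α₁ α₂ α₃ (op i j) :=
  groupAct_of _ _ _ i j

/-- The filtration of `T(α₁, α₂, α₃)` by degree in the generators: the `n`-th term is spanned by
the products of at most `n` generators. -/
def fil (n : ℕ) : Submodule K (DefAlg α₁ α₂ α₃) :=
  (1 ⊔ Submodule.span K (Set.range (gen α₁ α₂ α₃))) ^ n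

end DefAlg

namespace Nichols

variable (K)

/-- The generators of `B`. -/
def gen (i : Fin 4) : Nichols K := RingQuot.mkAlgHom K _ (FreeAlgebra.ι K i)

theorem adjoin_gen : Algebra.adjoin K (Set.range (gen K)) = ⊤ := adjoin_quot _

theorem quadRel : QuadRel (0 : K) 0 (gen K 0) (gen K 1) (gen K 2) (gen K 3) where
  aa := by simpa [gen] using RingQuot.mkAlgHom_rel K (NicholsRel.aa (K := K))
  bb := by simpa [gen] using RingQuot.mkAlgHom_rel K (NicholsRel.bb (K := K))
  cc := by simpa [gen] using RingQuot.mkAlgHom_rel K (NicholsRel.cc (K := K))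
  dd := by simpa [gen] using RingQuot.mkAlgHom_rel K (NicholsRel.dd (K := K))
  abc := by
    have := RingQuot.mkAlgHom_rel K (NicholsRel.abc (K := K))
    simp only [map_add, map_mul, map_zero] at this ⊢
    rw [← this]; simp only [gen]; abel
  acd := by
    have := RingQuot.mkAlgHom_rel K (NicholsRel.acd (K := K))
    simp only [map_add, map_mul, map_zero] at this ⊢
    rw [← this]; simp only [gen]; abel
  adb := by
    have := RingQuot.mkAlgHom_rel K (NicholsRel.adb (K := K))
    simp only [map_add, map_mul, map_zero] at this ⊢
    rw [← this]; simp only [gen]; abel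
  bdc := by
    have := RingQuot.mkAlgHom_rel K (NicholsRel.bdc (K := K))
    simp only [map_add, map_mul, map_zero] at this ⊢
    rw [← this]; simp only [gen]; abel

theorem six : (gen K 0 + gen K 1 + gen K 2) ^ 6 = 0 := by
  simpa only [map_pow, map_add, map_zero, gen] using
    RingQuot.mkAlgHom_rel K (NicholsRel.six (K := K))

theorem lift_aux {A : Type*} [Semiring A] [Algebra K A] {x : Fin 4 → A}
    (h : QuadRel (0 : K) 0 (x 0) (x 1) (x 2) (x 3)) (h6 : (x 0 + x 1 + x 2) ^ 6 = 0)
    ⦃y z : FreeAlgebra K (Fin 4)⦄ (hyz : NicholsRel K y z) :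
    FreeAlgebra.lift K x y = FreeAlgebra.lift K x z := by
  have h0 := map_zero (algebraMap K A)
  cases hyz <;> simp only [map_pow, map_add, map_mul, map_zero, FreeAlgebra.lift_ι_apply]
  · exact h.aa.trans h0
  · exact h.bb.trans h0
  · exact h.cc.trans h0
  · exact h.dd.trans h0
  · refine Eq.trans ?_ (h.abc.trans h0); abel
  · refine Eq.trans ?_ (h.acd.trans h0); abel
  · refine Eq.trans ?_ (h.adb.trans h0); abel
  · refine Eq.trans ?_ (h.bdc.trans h0); abel
  · exact h6

/-- The endomorphism of `B` given by the action of `g_i`: it sends the generator `x_j` to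
`-x_{i ▷ j}`. -/
def genAct (i : Fin 4) : Nichols K →ₐ[K] Nichols K :=
  RingQuot.liftAlgHom K ⟨FreeAlgebra.lift K fun j => - gen K (op i j),
    lift_aux K ((quadRel K).act i) <| by
      rw [((quadRel K).act i).pow_six, (quadRel K).cube_act i, ← (quadRel K).pow_six, six]⟩

theorem genAct_gen (i j : Fin 4) : genAct K i (gen K j) = - gen K (op i j) := by
  rw [genAct, gen, RingQuot.liftAlgHom_mkAlgHom_apply, FreeAlgebra.lift_ι_apply]

/-- The action of `G` on `B` by algebra automorphisms: `g_i` sends the generator `x_j` to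
`-x_{i ▷ j}`. -/
def act : EnvGroup →* (Nichols K ≃ₐ[K] Nichols K) :=
  groupAct (adjoin_gen K) (genAct K) (genAct_gen K)

theorem act_of_gen (i j : Fin 4) :
    act K (PresentedGroup.of i) (gen K j) = - gen K (op i j) :=
  groupAct_of _ _ _ i j

/-- The homogeneous component of degree `n` of `B`, spanned by the products of `n` generators. -/
def piece (n : ℕ) : Submodule K (Nichols K) := Submodule.span K (Set.range (gen K)) ^ n

instance : SetLike.GradedMonoid (piece K) :=
  inferInstanceAs (SetLike.GradedMonoid fun n : ℕ => Submodule.span K (Set.range (gen K)) ^ n)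

theorem gen_mem (i : Fin 4) : gen K i ∈ piece K 1 := by
  rw [piece, pow_one]; exact Submodule.subset_span ⟨i, rfl⟩

/-- The generators of `B` in the direct sum of its homogeneous components. -/
def grGen (i : Fin 4) : ⨁ n, piece K n := DirectSum.of (fun n => piece K n) 1 ⟨gen K i, gen_mem K i⟩

theorem of_mul_aux (i j : Fin 4) : grGen K i * grGen K j = DirectSum.of (fun n => piece K n) (1 + 1)
    ⟨gen K i * gen K j, SetLike.mul_mem_graded (gen_mem K i) (gen_mem K j)⟩ :=
  DirectSum.of_mul_of _ _

theorem gr_quadRel :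
    QuadRel (0 : K) 0 (grGen K 0) (grGen K 1) (grGen K 2) (grGen K 3) := by
  have h := quadRel K
  obtain ⟨h1, h2, h3, h4, h5, h6, h7, h8⟩ := h
  rw [map_zero] at *
  constructor <;> simp only [of_mul_aux, ← map_add, map_zero] <;>
    refine Eq.trans (congrArg _ (Subtype.ext ?_)) (map_zero (DirectSum.of (fun n => piece K n) (1 + 1)))
  exacts [h1, h2, h3, h4, h5, h6, h7, h8]

theorem gr_six : (grGen K 0 + grGen K 1 + grGen K 2) ^ 6 = 0 := by
  simp only [grGen, ← map_add]
  rw [DirectSum.ofPow]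
  refine Eq.trans (congrArg _ (Subtype.ext ?_)) (map_zero (DirectSum.of (fun n => piece K n) (6 • 1)))
  exact six K

/-- The decomposition of `B` into its homogeneous components. -/
def decomposition : Nichols K →ₐ[K] ⨁ n, piece K n :=
  RingQuot.liftAlgHom K ⟨FreeAlgebra.lift K (grGen K), lift_aux K (gr_quadRel K) (gr_six K)⟩

theorem decomposition_gen (i : Fin 4) : decomposition K (gen K i) = grGen K i := by
  rw [decomposition, gen, RingQuot.liftAlgHom_mkAlgHom_apply, FreeAlgebra.lift_ι_apply]

theorem decomposition_span {m : Nichols K} (hm : m ∈ Submodule.span K (Set.range (gen K))) :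
    decomposition K m = DirectSum.of (fun n => piece K n) 1 ⟨m, by rwa [piece, pow_one]⟩ := by
  induction hm using Submodule.span_induction with
  | mem x hx => obtain ⟨i, rfl⟩ := hx; exact decomposition_gen K i
  | zero => rw [map_zero]; exact (map_zero (DirectSum.of (fun n => piece K n) 1)).symm
  | add x y hx hy ihx ihy => rw [map_add, ihx, ihy, ← map_add]; rfl
  | smul r x hx ih => rw [map_smul, ih, ← DirectSum.lof_eq_of K, ← map_smul]; rfl

instance : GradedAlgebra (piece K) :=
  GradedAlgebra.ofAlgHom _ (decomposition K)
    (AlgHom.ext_of_adjoin_eq_top (adjoin_gen K) <| by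
      rintro _ ⟨i, rfl⟩
      rw [AlgHom.comp_apply, decomposition_gen, grGen, DirectSum.coeAlgHom_of]
      rfl)
    fun i x => by
    obtain ⟨x, hx⟩ := x
    dsimp only
    induction hx using Submodule.pow_induction_on_left' with
    | algebraMap r =>
      rw [AlgHom.commutes, DirectSum.algebraMap_apply]; rfl
    | add x y i hx hy ihx ihy =>
      rw [map_add, ihx, ihy, ← map_add]
      rfl
    | mem_mul m hm i x hx ih =>
      rw [map_mul, ih, decomposition_span K hm, DirectSum.of_mul_of]
      exact DirectSum.of_eq_of_gradedMonoid_eq (Sigma.subtype_ext (add_comm _ _) rfl)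

end Nichols

end Algebras

end Tetrahedron

/-!
The generators of `B` lift to a deformation `D` compatibly with the action of `G`, the lifts satisfy
the relations of some `T(α₁, α₂, α₃)`, and the resulting homomorphism `φ` to `D` is an isomorphism
because its associated graded map is one.

*Lifts.* The element `g_a ^ 3` is central in `G` and acts on the component of degree `n` of `B` by
`(-1) ^ n`. Hence `F_1` splits into the constants `F_0 = K` and the eigenspace of `g_a ^ 3` for `-1`,
which is a copy of the degree one part of `B` (`exists_lift`).

*Quadratic relations.* The squares of the lifts and the elements `ca + bc + ab`, … lie in `F_1` and
are fixed by `g_a ^ 3`, so they are constants. As `G` permutes the four squares and the four sums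
transitively, only two constants `α₁` and `α₂` occur (`exists_quadRel`).

*The last relation.* Put `y = cb + ba + ac - α₂`. Up to a constant this is `(a + b + c) ^ 2`, so
`y ^ 3` lies in `F_5`. It is invariant under `G` and commutes with `a`. An element of degree one to
five of `B` with these two properties vanishes (`Nichols.eq_zero_of_invariant`), so `y ^ 3` is a
constant `α₃` (`exists_cube`). In odd degrees the vanishing is due to `g_a ^ 3`. In even degrees `G`
acts through the even permutations of the generators; averaging over these shows that there are no
invariants in degree two, and that those in degree four are multiples of the average `w` of the word
`abac` (`Nichols.avgFour_mem_span`). Finally `w` does not commute with `a`, since the commutator acts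
nontrivially on an explicit ten-dimensional module (`Nichols.rep_commutator`).

*Bijectivity.* The relations of `B` hold in the associated graded algebra of `T(α₁, α₂, α₃)`, which
gives a homomorphism from `B` onto it. Composed with the graded map of `φ` and the given isomorphism
`gr D ≅ B` it is the identity on generators. So an element of `T(α₁, α₂, α₃)` whose image in `D` has
lower filtration degree has itself lower filtration degree (`DefAlg.exists_symbol`,
`DefAlg.eq_zero_of_map_eq_zero`), and no dimension has to be computed.
-/

/-! ### Filtrations and symbols -/

section Filtration

variable {K D : Type*} [Field K] [Ring D] [Algebra K D] (F : ℕ → Submodule K D)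

theorem lowerPart_zero : lowerPart F 0 = ⊥ := by simp [lowerPart]

variable [hF : IsRingFiltration F (lowerPart F)]

theorem lowerPart_succ (n : ℕ) : lowerPart F (n + 1) = F n :=
  le_antisymm (hF.is_sup _ _ fun _ hi => hF.mono (Nat.lt_succ_iff.1 hi)) (hF.is_le n.lt_succ_self)

theorem lowerPart_le (n : ℕ) : lowerPart F n ≤ F n := hF.is_sup _ _ fun _ hi => hF.mono hi.le

namespace GrPiece

theorem of_mk_eq_zero {n : ℕ} {x : ↥(F n)} :
    DirectSum.of (GrPiece F) n (mk F n x) = 0 ↔ (x : D) ∈ lowerPart F n := by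
  rw [← map_zero (DirectSum.of (GrPiece F) n), (DirectSum.of_injective n).eq_iff,
    ← map_zero (mk F n), mk_eq_mk]
  simp

theorem of_mk_mul {i j : ℕ} (x : ↥(F i)) (y : ↥(F j)) :
    DirectSum.of (GrPiece F) i (mk F i x) * DirectSum.of (GrPiece F) j (mk F j y) =
      DirectSum.of (GrPiece F) (i + j)
        (mk F (i + j) ⟨(x : D) * (y : D), SetLike.mul_mem_graded x.2 y.2⟩) :=
  DirectSum.of_mul_of _ _

theorem algebraMap_eq_of_mk (r : K) :
    algebraMap K (⨁ n, GrPiece F n) r =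
      DirectSum.of (GrPiece F) 0 (mk F 0 ⟨algebraMap K D r, algebraMap_mem_zero F r⟩) :=
  DirectSum.algebraMap_apply _ _ r

end GrPiece

variable {F} {A : Type*} [Semiring A] [Algebra K A]

/-- `IsSymbol ψ n z b` says that `z` lies in `F n` and that the algebra isomorphism `ψ` from the
associated graded algebra to `A` sends the class of `z` in `F n / F (n - 1)` to `b`. -/
def IsSymbol (ψ : (⨁ n, GrPiece F n) ≃ₐ[K] A) (n : ℕ) (z : D) (b : A) : Prop :=
  ∃ h : z ∈ F n, ψ (DirectSum.of (GrPiece F) n (GrPiece.mk F n ⟨z, h⟩)) = b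

namespace IsSymbol

variable {ψ : (⨁ n, GrPiece F n) ≃ₐ[K] A} {m n : ℕ} {y z : D} {b c : A}

theorem mem (h : IsSymbol ψ n z b) : z ∈ F n := h.1

theorem exists_of_mem (ψ : (⨁ n, GrPiece F n) ≃ₐ[K] A) (h : z ∈ F n) : ∃ b, IsSymbol ψ n z b :=
  ⟨_, h, rfl⟩

theorem unique (h : IsSymbol ψ n z b) (h' : IsSymbol ψ n z c) : b = c := by
  obtain ⟨_, rfl⟩ := h
  obtain ⟨_, rfl⟩ := h'
  rfl

theorem add (h : IsSymbol ψ n y b) (h' : IsSymbol ψ n z c) : IsSymbol ψ n (y + z) (b + c) := by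
  obtain ⟨hy, rfl⟩ := h
  obtain ⟨hz, rfl⟩ := h'
  exact ⟨add_mem hy hz, by rw [← map_add, ← map_add, ← map_add]; rfl⟩

theorem smul (r : K) (h : IsSymbol ψ n y b) : IsSymbol ψ n (r • y) (r • b) := by
  obtain ⟨hy, rfl⟩ := h
  refine ⟨(F n).smul_mem r hy, ?_⟩
  simp only [← DirectSum.lof_eq_of K]
  rw [← map_smul, ← map_smul, ← map_smul]
  rfl

theorem sub {A : Type*} [Ring A] [Algebra K A] {ψ : (⨁ n, GrPiece F n) ≃ₐ[K] A} {b c : A}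
    (h : IsSymbol ψ n y b) (h' : IsSymbol ψ n z c) : IsSymbol ψ n (y - z) (b - c) := by
  simpa [sub_eq_add_neg] using h.add (h'.smul (-1))

theorem mul (h : IsSymbol ψ m y b) (h' : IsSymbol ψ n z c) : IsSymbol ψ (m + n) (y * z) (b * c) := by
  obtain ⟨hy, rfl⟩ := h
  obtain ⟨hz, rfl⟩ := h'
  exact ⟨SetLike.mul_mem_graded hy hz, by rw [← map_mul, GrPiece.of_mk_mul]⟩

theorem zero_iff : IsSymbol ψ n z 0 ↔ z ∈ lowerPart F n := by
  constructor
  · rintro ⟨hz, h⟩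
    rwa [map_eq_zero_iff _ ψ.injective, GrPiece.of_mk_eq_zero] at h
  · intro h
    exact ⟨lowerPart_le F n h, by rwa [map_eq_zero_iff _ ψ.injective, GrPiece.of_mk_eq_zero]⟩

theorem scalar (r : K) : IsSymbol ψ 0 (algebraMap K D r) (algebraMap K A r) :=
  ⟨GrPiece.algebraMap_mem_zero F r, by rw [← GrPiece.algebraMap_eq_of_mk, AlgEquiv.commutes]⟩

theorem pow (h : IsSymbol ψ n z b) (k : ℕ) : IsSymbol ψ (k * n) (z ^ k) (b ^ k) := by
  induction k with
  | zero => simpa using IsSymbol.scalar (ψ := ψ) 1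
  | succ k ih => rw [Nat.succ_mul, pow_succ, pow_succ]; exact ih.mul h

theorem mem_graded {𝒜 : ℕ → Submodule K A}
    (hψ : ∀ n, (LinearMap.range (DirectSum.lof K ℕ (GrPiece F) n)).map ψ.toLinearMap = 𝒜 n)
    (h : IsSymbol ψ n z b) : b ∈ 𝒜 n := by
  obtain ⟨hz, rfl⟩ := h
  rw [← hψ n]
  exact ⟨_, ⟨_, rfl⟩, rfl⟩

theorem exists_of_mem_graded {𝒜 : ℕ → Submodule K A}
    (hψ : ∀ n, (LinearMap.range (DirectSum.lof K ℕ (GrPiece F) n)).map ψ.toLinearMap = 𝒜 n)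
    (hb : b ∈ 𝒜 n) : ∃ z, IsSymbol ψ n z b := by
  rw [← hψ n] at hb
  obtain ⟨_, ⟨x, rfl⟩, rfl⟩ := hb
  obtain ⟨x, rfl⟩ := GrPiece.mk_surjective F n x
  exact ⟨x, x.2, rfl⟩

end IsSymbol

end Filtration

section Equivariance

variable {K G D A : Type*} [Field K] [Group G] [Ring D] [Algebra K D] [Ring A] [Algebra K A]
  {𝓓 : FilteredGAlgebra K G D} {ρ : G →* (A ≃ₐ[K] A)} {ψ : 𝓓.Gr ≃ₐ[K] A}

theorem IsSymbol.act (hρ : ∀ (g : G) (z : 𝓓.Gr), ψ (𝓓.grAct g z) = ρ g (ψ z)) {n : ℕ} {z : D}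
    {b : A} (h : IsSymbol ψ n z b) (g : G) : IsSymbol ψ n (𝓓.act g z) (ρ g b) := by
  obtain ⟨hz, rfl⟩ := h
  refine ⟨𝓓.stable g n z hz, ?_⟩
  rw [← hρ, FilteredGAlgebra.grAct, ← DirectSum.lof_eq_of K, ← DirectSum.lof_eq_of K,
    DirectSum.lmap_lof, FilteredGAlgebra.grPieceAct_mk]

end Equivariance

namespace Tetrahedron

/-! ### Averaging over the even permutations of the rack -/

/-- The twelve even permutations of `Fin 4`: the one with index `(p, k)` sends `j` to
`p ▷ (0 ▷ (⋯ (0 ▷ j)))`, with `k` operations of `0`. The maps `p ▷ ·` are the four 3-cycles of one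
coset of the Klein four-group, so each even permutation is listed exactly once. -/
def evenPerm (q : Fin 4 × Fin 3) (j : Fin 4) : Fin 4 := op q.1 ((op 0)^[q.2] j)

theorem evenPerm_mul : ∀ q r, ∃ s, ∀ j, evenPerm q (evenPerm r j) = evenPerm s j := by decide

theorem evenPerm_injective : ∀ q r, (∀ j, evenPerm q j = evenPerm r j) → q = r := by decide

theorem evenPerm_surjective : ∀ q j, ∃ i, evenPerm q i = j := by decide

/-- The even permutations form a group, so a sum over them is unchanged by composition with one. -/
theorem sum_evenPerm_comp {M : Type*} [AddCommMonoid M] (f : (Fin 4 → Fin 4) → M)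
    (r : Fin 4 × Fin 3) : ∑ q, f (evenPerm q ∘ evenPerm r) = ∑ q, f (evenPerm q) := by
  choose s hs using fun q => evenPerm_mul q r
  have hinj : Function.Injective s := by
    intro q q' h
    refine evenPerm_injective q q' fun j => ?_
    obtain ⟨i, rfl⟩ := evenPerm_surjective r j
    rw [hs, hs, h]
  exact Fintype.sum_bijective s (Finite.injective_iff_bijective.1 hinj) _ _
    fun q => congrArg f (funext (hs q))

namespace Nichols

variable (K : Type*) [Field K]

/-- The sum of the images of the word `x_i x_j` under the even permutations. -/
def avgTwo (i j : Fin 4) : Nichols K := ∑ q, gen K (evenPerm q i) * gen K (evenPerm q j)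

/-- The sum of the images of the word `x_i x_j x_k x_l` under the even permutations. -/
def avgFour (i j k l : Fin 4) : Nichols K :=
  ∑ q, gen K (evenPerm q i) * (gen K (evenPerm q j) * (gen K (evenPerm q k) * gen K (evenPerm q l)))

theorem gen_mul_self (i : Fin 4) : gen K i * gen K i = 0 := by
  have h := quadRel K
  rw [← map_zero (algebraMap K (Nichols K))]
  fin_cases i
  exacts [h.aa, h.bb, h.cc, h.dd]

/-- The four cyclic relations of `B` in a uniform shape, which shows that they are permuted by every
map that respects the rack operation. -/
theorem gen_cycle (i j : Fin 4) :
    gen K i * gen K j + gen K j * gen K (op i j) + gen K (op i j) * gen K i = 0 := by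
  have h := quadRel K
  obtain ⟨-, -, -, -, h1, h2, h3, h4⟩ := h
  have hs := gen_mul_self K
  rw [map_zero] at h1 h2 h3 h4
  fin_cases i <;> fin_cases j <;>
    simp only [op, Fin.isValue, Fin.zero_eta, Fin.mk_one, Fin.reduceFinMk, Matrix.cons_val, hs,
      add_zero] <;>
    first
    | exact Eq.trans (by abel1) h1
    | exact Eq.trans (by abel1) h2
    | exact Eq.trans (by abel1) h3
    | exact Eq.trans (by abel1) h4

theorem op_evenPerm : ∀ q i j, op (evenPerm q i) (evenPerm q j) = evenPerm q (op i j) := by decide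

variable {K}

theorem avgTwo_congr (i j i' j' : Fin 4) (h : ∃ r, evenPerm r i = i' ∧ evenPerm r j = j') :
    avgTwo K i' j' = avgTwo K i j := by
  obtain ⟨r, rfl, rfl⟩ := h
  exact sum_evenPerm_comp (fun f => gen K (f i) * gen K (f j)) r

theorem avgFour_congr (i j k l i' j' k' l' : Fin 4)
    (h : ∃ r, evenPerm r i = i' ∧ evenPerm r j = j' ∧ evenPerm r k = k' ∧ evenPerm r l = l') :
    avgFour K i' j' k' l' = avgFour K i j k l := by
  obtain ⟨r, rfl, rfl, rfl, rfl⟩ := h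
  exact sum_evenPerm_comp
    (fun f => gen K (f i) * (gen K (f j) * (gen K (f k) * gen K (f l)))) r

/-- All words `x_i x_j` with `i ≠ j` have the same average, and three of them add up to zero. -/
theorem avgTwo_eq_zero (h3 : (3 : K) ≠ 0) (i j : Fin 4) : avgTwo K i j = 0 := by
  by_cases hij : i = j
  · subst hij
    simp [avgTwo, gen_mul_self]
  have e : avgTwo K i j + avgTwo K j (op i j) + avgTwo K (op i j) i = 0 := by
    simp only [avgTwo, ← Finset.sum_add_distrib, ← op_evenPerm, gen_cycle, Finset.sum_const_zero]
  have e1 : ∀ i j, i ≠ j → ∃ r, evenPerm r i = j ∧ evenPerm r j = op i j := by decide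
  have e2 : ∀ i j, i ≠ j → ∃ r, evenPerm r i = op i j ∧ evenPerm r j = i := by decide
  rw [avgTwo_congr _ _ _ _ (e1 i j hij), avgTwo_congr _ _ _ _ (e2 i j hij)] at e
  refine (smul_eq_zero.1 (?_ : (3 : K) • avgTwo K i j = 0)).resolve_left h3
  rw [← e]
  module

section

variable (i j k l : Fin 4)

theorem avgFour_left : avgFour K i i k l = 0 := by
  simp [avgFour, ← mul_assoc (gen K _) (gen K _) (gen K _ * gen K _), gen_mul_self]

theorem avgFour_mid : avgFour K i j j l = 0 := by
  simp [avgFour, ← mul_assoc (gen K _) (gen K _) (gen K _), gen_mul_self]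

theorem avgFour_right : avgFour K i j k k = 0 := by
  simp [avgFour, gen_mul_self]

theorem avgFour_cycle_left :
    avgFour K i j k l + avgFour K j (op i j) k l + avgFour K (op i j) i k l = 0 := by
  simp only [avgFour, ← mul_assoc (gen K _) (gen K _) (gen K _ * gen K _),
    ← Finset.sum_add_distrib, ← add_mul, ← op_evenPerm, gen_cycle, zero_mul, Finset.sum_const_zero]

theorem avgFour_cycle_mid :
    avgFour K k i j l + avgFour K k j (op i j) l + avgFour K k (op i j) i l = 0 := by
  simp only [avgFour, ← mul_assoc (gen K _) (gen K _) (gen K _),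
    ← Finset.sum_add_distrib, ← add_mul, ← mul_add, ← op_evenPerm, gen_cycle, zero_mul, mul_zero,
    Finset.sum_const_zero]

theorem avgFour_cycle_right :
    avgFour K k l i j + avgFour K k l j (op i j) + avgFour K k l (op i j) i = 0 := by
  simp only [avgFour, ← Finset.sum_add_distrib, ← mul_add, ← op_evenPerm, gen_cycle, mul_zero,
    Finset.sum_const_zero]

end
/-- The averages of the words of length four are multiples of the one of `x_0 x_1 x_0 x_2`: modulo
even permutations, the defining relations of degree two leave only this word. -/
theorem avgFour_mem_span (i j k l : Fin 4) :
    avgFour K i j k l ∈ Submodule.span K {avgFour K 0 1 0 2} := by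
  -- An even permutation moves any two distinct letters to `0, 1`, which leaves words `0 1 k l`.
  have key : ∀ k l, avgFour K 0 1 k l ∈ Submodule.span K {avgFour K 0 1 0 2} := by
    have hw := Submodule.mem_span_singleton_self (R := K) (avgFour K 0 1 0 2)
    have h1 : avgFour K 0 1 2 0 = 0 := by
      have e := avgFour_cycle_mid (K := K) 0 1 0 0
      rwa [avgFour_left, show op 0 1 = 2 from rfl, avgFour_right, zero_add, add_zero] at e
    have h2 : avgFour K 0 1 0 1 = 0 := by
      have e := avgFour_cycle_mid (K := K) 0 1 0 2
      rwa [avgFour_left, show op 0 1 = 2 from rfl, avgFour_right, zero_add, zero_add,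
        avgFour_congr 0 1 0 1 0 2 0 2 (by decide)] at e
    have h3 : avgFour K 0 1 2 1 = - avgFour K 0 1 0 2 := by
      have e := avgFour_cycle_left (K := K) 0 1 0 2
      rw [show op 0 1 = 2 from rfl, avgFour_congr 0 1 2 1 1 2 0 2 (by decide),
        avgFour_mid, add_zero] at e
      exact eq_neg_of_add_eq_zero_right e
    have h4 : avgFour K 0 1 0 3 = avgFour K 0 1 0 2 := by
      have e := avgFour_cycle_mid (K := K) 0 1 0 1
      rw [avgFour_left, show op 0 1 = 2 from rfl, avgFour_congr 0 1 0 3 0 2 0 1 (by decide),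
        h3, zero_add] at e
      exact (neg_add_eq_zero.1 e).symm
    have h5 : avgFour K 0 1 3 1 = - avgFour K 0 1 0 2 := by
      have e := avgFour_cycle_right (K := K) 0 1 0 2
      rw [show op 0 1 = 2 from rfl, avgFour_mid, avgFour_congr 0 1 0 3 0 2 0 1 (by decide),
        avgFour_congr 0 1 3 1 0 2 1 2 (by decide), add_zero, h4] at e
      exact eq_neg_of_add_eq_zero_right e
    have h6 : avgFour K 0 1 3 2 = avgFour K 0 1 0 2 := by
      have e := avgFour_cycle_mid (K := K) 0 1 3 0
      rw [show op 0 1 = 2 from rfl, avgFour_right, avgFour_congr 0 1 3 1 3 0 1 0 (by decide),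
        avgFour_congr 0 1 3 2 3 1 2 0 (by decide), add_zero, h5] at e
      exact (neg_add_eq_zero.1 e).symm
    have h7 : avgFour K 0 1 2 3 = - avgFour K 0 1 0 2 := by
      have e := avgFour_cycle_left (K := K) 0 1 0 3
      rw [show op 0 1 = 2 from rfl, avgFour_congr 0 1 2 3 1 2 0 3 (by decide), avgFour_mid,
        add_zero, h4] at e
      exact eq_neg_of_add_eq_zero_right e
    have h8 : avgFour K 0 1 3 0 = 0 := by
      have e := avgFour_cycle_left (K := K) 0 1 3 0
      rwa [show op 0 1 = 2 from rfl, avgFour_congr 0 1 3 2 1 2 3 0 (by decide),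
        avgFour_congr 0 1 3 1 2 0 3 0 (by decide), h5, h6, add_neg_cancel_right] at e
    intro k l
    fin_cases k <;> fin_cases l <;>
      simp only [Fin.isValue, Fin.zero_eta, Fin.mk_one, Fin.reduceFinMk, avgFour_mid, avgFour_right,
        h1, h2, h3, h4, h5, h6, h7, h8, hw, neg_mem hw, zero_mem]
  by_cases hij : i = j
  · rw [hij, avgFour_left]
    exact zero_mem _
  · have : ∀ i j, i ≠ j → ∃ r, evenPerm r 0 = i ∧ evenPerm r 1 = j := by decide
    obtain ⟨r, hi, hj⟩ := this i j hij
    obtain ⟨k', hk⟩ := evenPerm_surjective r k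
    obtain ⟨l', hl⟩ := evenPerm_surjective r l
    rw [avgFour_congr 0 1 k' l' i j k l ⟨r, hi, hj, hk, hl⟩]
    exact key k' l'

/-! ### A ten-dimensional module over the Nichols algebra -/

section Representation

variable (K)

/-- Matrix units of size ten. -/
def unit10 (i j : Fin 10) : Matrix (Fin 10) (Fin 10) K := Matrix.single i j 1

theorem unit10_mul (i j k l : Fin 10) :
    unit10 K i j * unit10 K k l = if j = k then unit10 K i l else 0 := by
  split_ifs with h
  · subst h; simp [unit10]
  · exact Matrix.single_mul_single_of_ne _ _ _ _ h _

/-- The action of the generators of `B` on a ten-dimensional graded module, whose basis vectors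
`0, …, 9` have the degrees `0, 1, 1, 2, 2, 3, 3, 4, 4, 5`. It is the quotient of the left module `B`
by the largest submodule on which a certain linear functional, supported in degree five,
vanishes. -/
def genMatrix : Fin 4 → Matrix (Fin 10) (Fin 10) K :=
  ![unit10 K 3 2 + unit10 K 5 4 + unit10 K 7 6 + unit10 K 9 8,
    unit10 K 1 0 + unit10 K 4 2 + unit10 K 6 3 + unit10 K 7 5,
    unit10 K 8 6 - unit10 K 4 1 - unit10 K 5 3,
    unit10 K 2 0 - unit10 K 3 1 - unit10 K 6 4 + unit10 K 8 5 - unit10 K 9 7]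

theorem genMatrix_quadRel :
    QuadRel (0 : K) 0 (genMatrix K 0) (genMatrix K 1) (genMatrix K 2) (genMatrix K 3) := by
  constructor <;>
    simp [genMatrix, mul_add, add_mul, mul_sub, sub_mul, unit10_mul] <;> abel

theorem genMatrix_six : (genMatrix K 0 + genMatrix K 1 + genMatrix K 2) ^ 6 = 0 := by
  rw [(genMatrix_quadRel K).pow_six]
  simp [genMatrix, mul_add, add_mul, mul_sub, sub_mul, unit10_mul, pow_succ]

/-- The ten-dimensional representation of `B` with the generators acting by `genMatrix`. -/
def rep : Nichols K →ₐ[K] Matrix (Fin 10) (Fin 10) K :=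
  RingQuot.liftAlgHom K ⟨FreeAlgebra.lift K (genMatrix K),
    lift_aux K (genMatrix_quadRel K) (genMatrix_six K)⟩

theorem rep_gen (i : Fin 4) : rep K (gen K i) = genMatrix K i := by
  rw [rep, gen, RingQuot.liftAlgHom_mkAlgHom_apply, FreeAlgebra.lift_ι_apply]

theorem rep_avgFour : rep K (avgFour K 0 1 0 2) =
    unit10 K 7 0 + unit10 K 8 0 - unit10 K 9 1 + unit10 K 9 2 := by
  simp only [avgFour, map_mul, map_sum, rep_gen]
  simp only [Fintype.sum_prod_type, Fin.sum_univ_succ, Finset.univ_eq_empty, Finset.sum_empty,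
    evenPerm]
  simp [op, genMatrix, mul_add, add_mul, mul_sub, sub_mul, unit10_mul]
  abel

/-- The matrix is nonzero in every characteristic, so `a` does not commute with the average of the
word `a b a c`. -/
theorem rep_commutator :
    rep K (gen K 0 * avgFour K 0 1 0 2 - avgFour K 0 1 0 2 * gen K 0) = unit10 K 9 0 := by
  rw [map_sub, map_mul, map_mul, rep_avgFour, rep_gen]
  simp [genMatrix, mul_add, add_mul, mul_sub, sub_mul, unit10_mul]

end Representation
end Nichols

/-! ### Invariants of the Nichols algebra in low degrees -/

/-- The generator `g_i` of the enveloping group. -/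
abbrev g (i : Fin 4) : EnvGroup := PresentedGroup.of i

theorem g_mul_g {i j k l : Fin 4}
    (h : FreeGroup.of i * FreeGroup.of j * (FreeGroup.of k * FreeGroup.of l)⁻¹ ∈ groupRels) :
    g i * g j = g k * g l := by
  have := PresentedGroup.one_of_mem h
  rwa [map_mul, map_inv, mul_inv_eq_one] at this

/-- The cube of `g_a` is central in the enveloping group: conjugation by `g_a` permutes the other
three generators cyclically. -/
theorem commute_g_cube (i : Fin 4) : Commute (g 0 ^ 3) (g i) := by
  have h1 : g 0 * g 1 = g 2 * g 0 :=
    (g_mul_g (i := 0) (j := 1) (k := 1) (l := 2) (by simp [groupRels])).trans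
      (g_mul_g (by simp [groupRels]))
  have h2 : g 0 * g 2 = g 3 * g 0 :=
    (g_mul_g (i := 0) (j := 2) (k := 2) (l := 3) (by simp [groupRels])).trans
      (g_mul_g (by simp [groupRels]))
  have h3 : g 0 * g 3 = g 1 * g 0 :=
    (g_mul_g (i := 0) (j := 3) (k := 3) (l := 1) (by simp [groupRels])).trans
      (g_mul_g (by simp [groupRels]))
  have key : ∀ x y z : EnvGroup, g 0 * x = y * g 0 → g 0 * y = z * g 0 → g 0 * z = x * g 0 →
      Commute (g 0 ^ 3) x := by
    intro x y z hx hy hz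
    rw [commute_iff_eq]
    simp only [pow_succ, pow_zero, one_mul, mul_assoc, hx]
    rw [← mul_assoc (g 0) y, hy, mul_assoc, ← mul_assoc (g 0) z, hz, mul_assoc]
  fin_cases i
  · exact (Commute.refl _).pow_left 3
  · exact key _ _ _ h1 h2 h3
  · exact key _ _ _ h2 h3 h1
  · exact key _ _ _ h3 h1 h2

/-! Sign rules stated for a general algebra; for `RingQuot` itself, `rw` and `simp` do not unify the
instances that the library lemmas on signs need. -/

section Signs

variable {K A : Type*} [Field K] [Ring A] [Algebra K A]

theorem neg_mul_smul (r : K) (x y : A) : -x * r • y = (r * -1) • (x * y) := by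
  rw [mul_neg_one, neg_smul, neg_mul, mul_smul_comm]

theorem neg_mul_neg_four (x y z w : A) : -x * (-y * (-z * -w)) = x * (y * (z * w)) := by
  simp only [neg_mul, mul_neg, neg_neg]

theorem eq_zero_of_eq_neg_smul (h2 : (2 : K) ≠ 0) {x : A} (h : x = (-1 : K) • x) : x = 0 := by
  rw [neg_smul, one_smul, ← sub_eq_zero, sub_neg_eq_add, ← two_smul K] at h
  exact (smul_eq_zero.1 h).resolve_left h2

end Signs

namespace Nichols

variable {K : Type*} [Field K]

theorem act_cube {n : ℕ} {b : Nichols K} (hb : b ∈ piece K n) :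
    act K (g 0 ^ 3) b = (-1 : K) ^ n • b := by
  have hg : ∀ j, act K (g 0 ^ 3) (gen K j) = - gen K j := by
    intro j
    have : op 0 (op 0 (op 0 j)) = j := by revert j; decide
    simp only [pow_succ, pow_zero, one_mul, map_mul, AlgEquiv.mul_apply, act_of_gen, map_neg,
      neg_neg, this]
  have hs : ∀ m ∈ Submodule.span K (Set.range (gen K)), act K (g 0 ^ 3) m = - m := by
    intro m hm
    induction hm using Submodule.span_induction with
    | mem x hx => obtain ⟨i, rfl⟩ := hx; exact hg i
    | zero => simp
    | add x y _ _ hx hy => rw [map_add, hx, hy, neg_add]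
    | smul r x _ hx => rw [map_smul, hx, smul_neg]
  rw [piece] at hb
  induction hb using Submodule.pow_induction_on_left' with
  | algebraMap r => rw [AlgEquiv.commutes, pow_zero, one_smul]
  | add x y i _ _ hx hy => rw [map_add, hx, hy, smul_add]
  | mem_mul m hm i x _ hx =>
    rw [map_mul, hx, hs m hm, pow_succ]
    exact neg_mul_smul _ _ _

theorem act_evenPerm (q : Fin 4 × Fin 3) :
    (∀ j, act K (g q.1 * g 0 ^ (q.2 : ℕ)) (gen K j) = gen K (evenPerm q j)) ∨
    (∀ j, act K (g q.1 * g 0 ^ (q.2 : ℕ)) (gen K j) = - gen K (evenPerm q j)) := by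
  obtain ⟨p, k⟩ := q
  fin_cases k
  · right
    intro j
    simp [act_of_gen, evenPerm]
  · left
    intro j
    simp [act_of_gen, evenPerm]
  · right
    intro j
    simp [act_of_gen, evenPerm, pow_two]

variable (K) in
/-- The sum of twelve elements of the enveloping group that induce, up to sign, the even
permutations of the generators, as a linear operator on `B`. -/
def average : Nichols K →ₗ[K] Nichols K :=
  ∑ q : Fin 4 × Fin 3, (act K (g q.1 * g 0 ^ (q.2 : ℕ))).toLinearMap

theorem average_apply (b : Nichols K) :
    average K b = ∑ q : Fin 4 × Fin 3, act K (g q.1 * g 0 ^ (q.2 : ℕ)) b := by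
  simp [average]

theorem average_of_invariant {b : Nichols K} (hb : ∀ γ, act K γ b = b) :
    average K b = (12 : K) • b := by
  rw [average_apply, Finset.sum_congr rfl fun q _ => hb _]
  simp only [Finset.sum_const, Finset.card_univ, Fintype.card_prod, Fintype.card_fin,
    ← Nat.cast_smul_eq_nsmul K]
  norm_num

theorem average_two (i j : Fin 4) : average K (gen K i * gen K j) = avgTwo K i j := by
  rw [average_apply]
  refine Finset.sum_congr rfl fun q _ => ?_
  rcases act_evenPerm (K := K) q with h | h <;> simp only [map_mul _ (gen K _), h]
  exact neg_mul_neg (gen K _) _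

theorem average_four (i j k l : Fin 4) :
    average K (gen K i * (gen K j * (gen K k * gen K l))) = avgFour K i j k l := by
  rw [average_apply]
  refine Finset.sum_congr rfl fun q _ => ?_
  rcases act_evenPerm (K := K) q with h | h <;> simp only [map_mul _ (gen K _), h]
  exact neg_mul_neg_four _ _ _ _

theorem average_piece_two (h3 : (3 : K) ≠ 0) {b : Nichols K} (hb : b ∈ piece K 2) :
    average K b = 0 := by
  have : piece K 2 ≤ LinearMap.ker (average K) := by
    rw [piece, pow_two, Submodule.span_mul_span, Submodule.span_le]
    rintro _ ⟨_, ⟨i, rfl⟩, _, ⟨j, rfl⟩, rfl⟩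
    exact (average_two i j).trans (avgTwo_eq_zero h3 i j)
  exact this hb

theorem average_piece_four {b : Nichols K} (hb : b ∈ piece K 4) :
    average K b ∈ Submodule.span K {avgFour K 0 1 0 2} := by
  have : piece K 4 ≤ (Submodule.span K {avgFour K 0 1 0 2}).comap (average K) := by
    rw [piece, pow_succ', pow_succ', pow_two, Submodule.span_mul_span, Submodule.span_mul_span,
      Submodule.span_mul_span, Submodule.span_le]
    rintro _ ⟨_, ⟨i, rfl⟩, _, ⟨_, ⟨j, rfl⟩, _, ⟨_, ⟨k, rfl⟩, _, ⟨l, rfl⟩, rfl⟩, rfl⟩, rfl⟩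
    exact (congrArg (· ∈ _) (average_four i j k l)).mpr (avgFour_mem_span i j k l)
  exact this hb

/-- The part of `B` in the degrees one to five contains no invariant element that commutes with the
generator `a`. In odd degrees the central element `g_a ^ 3` acts by `-1`. In degree two there are no
invariants, and those of degree four are multiples of a single element, which does not commute
with `a`. -/
theorem eq_zero_of_invariant (h2 : (2 : K) ≠ 0) (h3 : (3 : K) ≠ 0) {n : ℕ} (hn : n < 5)
    {b : Nichols K} (hb : b ∈ piece K (n + 1)) (hG : ∀ γ, act K γ b = b)
    (hc : Commute b (gen K 0)) : b = 0 := by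
  have h12 : (12 : K) ≠ 0 := by
    rw [show (12 : K) = 2 * (2 * 3) by norm_num]
    exact mul_ne_zero h2 (mul_ne_zero h2 h3)
  by_cases hodd : Odd (n + 1)
  · have e := (hG _).symm.trans (act_cube hb)
    rw [hodd.neg_one_pow] at e
    exact eq_zero_of_eq_neg_smul h2 e
  have ha := average_of_invariant hG
  have : n = 1 ∨ n = 3 := by
    interval_cases n <;> first | exact absurd (by decide) hodd | simp
  obtain rfl | rfl := this
  · rw [average_piece_two h3 hb] at ha
    exact (smul_eq_zero.1 ha.symm).resolve_left h12
  · obtain ⟨r, hr⟩ := Submodule.mem_span_singleton.1 (average_piece_four hb)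
    rw [ha] at hr
    have hr0 : r = 0 := by
      have e : r • (gen K 0 * avgFour K 0 1 0 2 - avgFour K 0 1 0 2 * gen K 0) = 0 := by
        rw [smul_sub, ← mul_smul_comm, ← smul_mul_assoc, hr, smul_mul_assoc, mul_smul_comm, hc.eq,
          sub_self]
      have e' := congrArg (rep K) e
      rw [map_smul, rep_commutator, map_zero] at e'
      simpa [unit10] using congrFun (congrFun e' 9) 0
    rw [hr0, zero_smul] at hr
    exact (smul_eq_zero.1 hr.symm).resolve_left h12

end Nichols

/-! ### Generators and relations of a deformation -/

section Symbols

variable {K D A : Type*} [Field K] [Ring D] [Algebra K D] [Semiring A] [Algebra K A]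
  {F : ℕ → Submodule K D} [hF : IsRingFiltration F (lowerPart F)]
  {ψ : (⨁ n, GrPiece F n) ≃ₐ[K] A}

theorem mem_lowerPart_of_isSymbol_lt {m n : ℕ} (hmn : m < n) {z : D} {b : A}
    (h : IsSymbol ψ m z b) : z ∈ lowerPart F n :=
  hF.is_le hmn h.mem

/-- The symbol of a constant vanishes in positive degrees. -/
theorem isSymbol_scalar_succ (n : ℕ) (r : K) : IsSymbol ψ (n + 1) (algebraMap K D r) 0 :=
  IsSymbol.zero_iff.2 (mem_lowerPart_of_isSymbol_lt n.succ_pos (IsSymbol.scalar (ψ := ψ) r))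

/-- Up to a constant, the element `y` whose cube enters the last relation of `T(α₁, α₂, α₃)` is
`(a + b + c)²`. -/
theorem isSymbol_cube {p q : K} {a b c d : D} (h : QuadRel p q a b c d) {u v w : A}
    (ha : IsSymbol ψ 1 a u) (hb : IsSymbol ψ 1 b v) (hc : IsSymbol ψ 1 c w) :
    IsSymbol ψ 6 ((c * b + b * a + a * c - algebraMap K D q) ^ 3) ((u + v + w) ^ 6) := by
  have e : c * b + b * a + a * c - algebraMap K D q =
      (a + b + c) ^ 2 + algebraMap K D (-(3 * p + 2 * q)) := by
    have e1 : (a + b + c) ^ 2 = a * a + b * b + c * c + (c * a + b * c + a * b)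
        + (c * b + b * a + a * c) := by
      rw [pow_two]; simp only [mul_add, add_mul]; abel
    rw [e1, h.aa, h.bb, h.cc, h.abc]
    simp only [Algebra.algebraMap_eq_smul_one]
    module
  rw [e, show (u + v + w) ^ 6 = ((u + v + w) ^ 2 + 0) ^ 3 by rw [add_zero, ← pow_mul]]
  exact (((ha.add hb).add hc).pow 2 |>.add (isSymbol_scalar_succ 1 _)).pow 3

end Symbols

section Deformation

variable {K D : Type*} [Field K] [Ring D] [Algebra K D] {𝓓 : FilteredGAlgebra K EnvGroup D}
  {ψ : 𝓓.Gr ≃ₐ[K] Nichols K}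

theorem exists_scalar_of_mem_zero
    (hψ : ∀ n, (LinearMap.range (DirectSum.lof K ℕ (GrPiece 𝓓.fil) n)).map ψ.toLinearMap =
      Nichols.piece K n) {z : D} (hz : z ∈ 𝓓.fil 0) : ∃ r, z = algebraMap K D r := by
  obtain ⟨b, hb⟩ := IsSymbol.exists_of_mem ψ hz
  have hm := hb.mem_graded hψ
  rw [Nichols.piece, pow_zero] at hm
  obtain ⟨r, rfl⟩ := Submodule.mem_one.1 hm
  have h := hb.sub (IsSymbol.scalar r)
  rw [sub_self, IsSymbol.zero_iff, lowerPart_zero, Submodule.mem_bot] at h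
  exact ⟨r, sub_eq_zero.1 h⟩

/-- The action of the central element `g_a ^ 3` separates the constants from the generators. -/
theorem exists_scalar_of_mem_one (h2 : (2 : K) ≠ 0)
    (hψ : ∀ n, (LinearMap.range (DirectSum.lof K ℕ (GrPiece 𝓓.fil) n)).map ψ.toLinearMap =
      Nichols.piece K n)
    (hρ : ∀ (γ : EnvGroup) (z : 𝓓.Gr), ψ (𝓓.grAct γ z) = Nichols.act K γ (ψ z))
    {z : D} (hz : z ∈ 𝓓.fil 1) (hT : 𝓓.act (g 0 ^ 3) z = z) : ∃ r, z = algebraMap K D r := by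
  obtain ⟨b, hb⟩ := IsSymbol.exists_of_mem ψ hz
  have h := hb.act hρ (g 0 ^ 3)
  rw [hT, Nichols.act_cube (hb.mem_graded hψ), pow_one] at h
  obtain rfl : b = 0 := eq_zero_of_eq_neg_smul h2 (hb.unique h)
  rw [IsSymbol.zero_iff, lowerPart_succ] at hb
  exact exists_scalar_of_mem_zero hψ hb

/-- The symbol of an invariant element that commutes with `a` has both properties too, so it vanishes
in the degrees one to five. -/
theorem exists_scalar_of_invariant (h2 : (2 : K) ≠ 0) (h3 : (3 : K) ≠ 0)
    (hψ : ∀ n, (LinearMap.range (DirectSum.lof K ℕ (GrPiece 𝓓.fil) n)).map ψ.toLinearMap =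
      Nichols.piece K n)
    (hρ : ∀ (γ : EnvGroup) (z : 𝓓.Gr), ψ (𝓓.grAct γ z) = Nichols.act K γ (ψ z))
    {a z : D} (ha : IsSymbol ψ 1 a (Nichols.gen K 0)) (hG : ∀ γ, 𝓓.act γ z = z)
    (hc : Commute z a) {n : ℕ} (hn : n ≤ 5) (hz : z ∈ 𝓓.fil n) : ∃ r, z = algebraMap K D r := by
  induction n with
  | zero => exact exists_scalar_of_mem_zero hψ hz
  | succ n ih =>
    obtain ⟨b, hb⟩ := IsSymbol.exists_of_mem ψ hz
    have hca : Commute b (Nichols.gen K 0) := by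
      have h := ha.mul hb
      rw [← hc.eq, add_comm] at h
      exact (hb.mul ha).unique h
    obtain rfl : b = 0 := Nichols.eq_zero_of_invariant h2 h3 hn (hb.mem_graded hψ)
      (fun γ => by
        have h := hb.act hρ γ
        rw [hG] at h
        exact h.unique hb) hca
    rw [IsSymbol.zero_iff, lowerPart_succ] at hb
    exact ih (by omega) hb

/-- The generators of `B` lift to elements on which the group acts as on the generators: the lifts
are the eigenvectors of `g_a ^ 3` with eigenvalue `-1`. -/
theorem exists_lift (h2 : (2 : K) ≠ 0)
    (hψ : ∀ n, (LinearMap.range (DirectSum.lof K ℕ (GrPiece 𝓓.fil) n)).map ψ.toLinearMap =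
      Nichols.piece K n)
    (hρ : ∀ (γ : EnvGroup) (z : 𝓓.Gr), ψ (𝓓.grAct γ z) = Nichols.act K γ (ψ z)) :
    ∃ x : Fin 4 → D, (∀ j, IsSymbol ψ 1 (x j) (Nichols.gen K j)) ∧
      ∀ i j, 𝓓.act (g i) (x j) = - x (op i j) := by
  have key : ∀ j, ∃ x, IsSymbol ψ 1 x (Nichols.gen K j) ∧ 𝓓.act (g 0 ^ 3) x = - x := by
    intro j
    obtain ⟨x, hx⟩ := IsSymbol.exists_of_mem_graded hψ (Nichols.gen_mem K j)
    have h := hx.add (hx.act hρ (g 0 ^ 3))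
    rw [Nichols.act_cube (Nichols.gen_mem K j), pow_one,
      show Nichols.gen K j + (-1 : K) • Nichols.gen K j = 0 by module,
      IsSymbol.zero_iff, lowerPart_succ] at h
    obtain ⟨r, hr⟩ := exists_scalar_of_mem_zero hψ h
    -- `x + g_a ^ 3 • x` is the constant `r`, so `x - r / 2` is the wanted eigenvector.
    have hs := hx.sub (isSymbol_scalar_succ 0 (r / 2))
    rw [sub_zero] at hs
    refine ⟨_, hs, ?_⟩
    rw [map_sub, AlgEquiv.commutes, eq_sub_of_add_eq' hr]
    have : algebraMap K D r = algebraMap K D (r / 2) + algebraMap K D (r / 2) := by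
      rw [← map_add, ← two_mul, mul_div_cancel₀ _ h2]
    rw [this]
    abel
  choose x hx hT using key
  refine ⟨x, hx, fun i j => ?_⟩
  have h := ((hx j).act hρ (g i)).add (hx (op i j))
  rw [Nichols.act_of_gen, neg_add_cancel, IsSymbol.zero_iff, lowerPart_succ] at h
  obtain ⟨r, hr⟩ := exists_scalar_of_mem_zero hψ h
  -- The difference is a constant, fixed by `g_a ^ 3`, while both terms are multiplied by `-1`.
  have e : 𝓓.act (g 0 ^ 3) (𝓓.act (g i) (x j) + x (op i j)) =
      -(𝓓.act (g i) (x j) + x (op i j)) := by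
    rw [map_add, ← AlgEquiv.mul_apply, ← map_mul, (commute_g_cube i).eq, map_mul,
      AlgEquiv.mul_apply, hT, hT, map_neg, neg_add]
  rw [hr, AlgEquiv.commutes] at e
  refine eq_neg_of_add_eq_zero_left (hr.trans (eq_zero_of_eq_neg_smul h2 ?_))
  rwa [neg_one_smul]

/-- The quadratic expressions that vanish in `B` are constants in the deformation, and the group
identifies the constants of one kind. -/
theorem exists_quadRel (h2 : (2 : K) ≠ 0)
    (hψ : ∀ n, (LinearMap.range (DirectSum.lof K ℕ (GrPiece 𝓓.fil) n)).map ψ.toLinearMap =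
      Nichols.piece K n)
    (hρ : ∀ (γ : EnvGroup) (z : 𝓓.Gr), ψ (𝓓.grAct γ z) = Nichols.act K γ (ψ z))
    {x : Fin 4 → D} (hx : ∀ j, IsSymbol ψ 1 (x j) (Nichols.gen K j))
    (hact : ∀ i j, 𝓓.act (g i) (x j) = - x (op i j)) :
    ∃ p q : K, QuadRel p q (x 0) (x 1) (x 2) (x 3) := by
  have hT : ∀ j, 𝓓.act (g 0 ^ 3) (x j) = - x j := by
    intro j
    have : op 0 (op 0 (op 0 j)) = j := by revert j; decide
    simp only [pow_succ, pow_zero, one_mul, map_mul, AlgEquiv.mul_apply, hact, map_neg,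
      neg_neg, this]
  have hB := Nichols.quadRel K
  obtain ⟨p, hp⟩ : ∃ p, x 0 * x 0 = algebraMap K D p := by
    refine exists_scalar_of_mem_one h2 hψ hρ ?_ (by simp only [map_mul _ (x _), hT, neg_mul_neg])
    have h := (hx 0).mul (hx 0)
    rwa [hB.aa, map_zero, IsSymbol.zero_iff, lowerPart_succ] at h
  obtain ⟨q, hq⟩ : ∃ q, x 2 * x 0 + x 1 * x 2 + x 0 * x 1 = algebraMap K D q := by
    refine exists_scalar_of_mem_one h2 hψ hρ ?_
      (by simp only [map_add, map_mul _ (x _), hT, neg_mul_neg])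
    have h := (((hx 2).mul (hx 0)).add ((hx 1).mul (hx 2))).add ((hx 0).mul (hx 1))
    rwa [hB.abc, map_zero, IsSymbol.zero_iff, lowerPart_succ] at h
  have hp' : ∀ i, x (op i 0) * x (op i 0) = algebraMap K D p := by
    intro i
    have h := congrArg (𝓓.act (g i)) hp
    rwa [AlgEquiv.commutes, map_mul, hact, neg_mul_neg] at h
  have hq' : ∀ i, x (op i 2) * x (op i 0) + x (op i 1) * x (op i 2) + x (op i 0) * x (op i 1) =
      algebraMap K D q := by
    intro i
    have h := congrArg (𝓓.act (g i)) hq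
    simpa only [AlgEquiv.commutes, map_add, map_mul _ (x _), hact, neg_mul_neg] using h
  exact ⟨p, q, hp, hp' 2, hp' 3, hp' 1, hq, hq' 0,
    Eq.trans (by simp only [show op 1 0 = 3 from rfl, show op 1 1 = 1 from rfl,
      show op 1 2 = 0 from rfl]; abel) (hq' 1),
    Eq.trans (by simp only [show op 2 0 = 1 from rfl, show op 2 1 = 3 from rfl,
      show op 2 2 = 2 from rfl]; abel) (hq' 2)⟩

/-- Conjugation by `y` permutes `a, b, c` cyclically, so `y ^ 3` commutes with `a`. -/
theorem QuadRel.commute_cube {p q : K} {a b c d : D} (h : QuadRel p q a b c d) :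
    Commute ((c * b + b * a + a * c - algebraMap K D q) ^ 3) a := by
  obtain ⟨ha, hb, hc, hd, h1, -, -, -⟩ := h
  simp only [Algebra.algebraMap_eq_smul_one] at *
  have yb := skew_aux p q a b c ha hb h1
  have yc := skew_aux p q b c a hb hc (by rw [← h1]; abel)
  have ya := skew_aux p q c a b hc ha (by rw [← h1]; abel)
  rw [show a * c + c * b + b * a = c * b + b * a + a * c by abel] at yc
  rw [show b * a + a * c + c * b = c * b + b * a + a * c by abel] at ya
  set y := c * b + b * a + a * c - q • 1
  rw [commute_iff_eq]
  simp only [pow_succ, pow_zero, one_mul, mul_assoc, ya]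
  rw [← mul_assoc y c, yc, mul_assoc, ← mul_assoc y b, yb, mul_assoc]

theorem exists_cube (h2 : (2 : K) ≠ 0) (h3 : (3 : K) ≠ 0)
    (hψ : ∀ n, (LinearMap.range (DirectSum.lof K ℕ (GrPiece 𝓓.fil) n)).map ψ.toLinearMap =
      Nichols.piece K n)
    (hρ : ∀ (γ : EnvGroup) (z : 𝓓.Gr), ψ (𝓓.grAct γ z) = Nichols.act K γ (ψ z))
    {x : Fin 4 → D} (hx : ∀ j, IsSymbol ψ 1 (x j) (Nichols.gen K j))
    (hact : ∀ i j, 𝓓.act (g i) (x j) = - x (op i j)) {p q : K}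
    (h : QuadRel p q (x 0) (x 1) (x 2) (x 3)) :
    ∃ r : K, (x 2 * x 1 + x 1 * x 0 + x 0 * x 2 - algebraMap K D q) ^ 3 = algebraMap K D r := by
  have hs := isSymbol_cube h (hx 0) (hx 1) (hx 2)
  rw [Nichols.six, IsSymbol.zero_iff, lowerPart_succ] at hs
  refine exists_scalar_of_invariant h2 h3 hψ hρ (hx 0) (fun γ => ?_) h.commute_cube le_rfl hs
  induction γ using PresentedGroup.induction_on with
  | _ w =>
  induction w using FreeGroup.induction_on with
  | C1 => rw [map_one, map_one, AlgEquiv.one_apply]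
  | of i =>
    refine Eq.trans ?_ (h.cube_act i)
    have := hact i
    simp only [map_pow _ (_ - _), map_sub, map_add, map_mul _ (x _), AlgEquiv.commutes]
    exact congrArg (· ^ 3) (by rw [← this, ← this, ← this]; rfl)
  | inv_of i hi =>
    rw [map_inv, map_inv, AlgEquiv.aut_inv, AlgEquiv.symm_apply_eq]
    exact hi.symm
  | mul v w hv hw => rw [map_mul, map_mul, AlgEquiv.mul_apply, hw, hv]

end Deformation

/-! ### Comparison with `T(α₁, α₂, α₃)` -/

namespace DefAlg

variable {K : Type*} [Field K] {α₁ α₂ α₃ : K}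

variable (α₁ α₂ α₃) in
theorem fil_monotone : Monotone (fil α₁ α₂ α₃) :=
  fun _ _ h => pow_right_mono₀ (show (1 : Submodule K (DefAlg α₁ α₂ α₃)) ≤ _ from le_sup_left) h

instance : IsRingFiltration (fil α₁ α₂ α₃) (lowerPart (fil α₁ α₂ α₃)) where
  mono := fil_monotone α₁ α₂ α₃
  is_le h := le_iSup₂_of_le _ h le_rfl
  is_sup _ _ h := iSup₂_le h
  one_mem := by
    rw [fil, pow_zero]
    exact Submodule.one_le.1 le_rfl
  mul_mem i j x y hx hy := by
    rw [fil, pow_add]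
    exact Submodule.mul_mem_mul hx hy

theorem gen_mem_fil (i : Fin 4) : gen α₁ α₂ α₃ i ∈ fil α₁ α₂ α₃ 1 := by
  rw [fil, pow_one]
  exact Submodule.mem_sup_right (Submodule.subset_span ⟨i, rfl⟩)

variable (α₁ α₂ α₃) in
/-- The classes of the generators in the associated graded algebra of `T(α₁, α₂, α₃)`. -/
def grGen (i : Fin 4) : ⨁ n, GrPiece (fil α₁ α₂ α₃) n :=
  DirectSum.of _ 1 (GrPiece.mk _ 1 ⟨gen α₁ α₂ α₃ i, gen_mem_fil i⟩)

theorem isSymbol_gen (i : Fin 4) :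
    IsSymbol (K := K) (AlgEquiv.refl) 1 (gen α₁ α₂ α₃ i) (grGen α₁ α₂ α₃ i) :=
  ⟨gen_mem_fil i, rfl⟩

theorem grGen_quadRel :
    QuadRel (0 : K) 0 (grGen α₁ α₂ α₃ 0) (grGen α₁ α₂ α₃ 1) (grGen α₁ α₂ α₃ 2)
      (grGen α₁ α₂ α₃ 3) := by
  have hsq : ∀ {i j r}, gen α₁ α₂ α₃ i * gen α₁ α₂ α₃ j = algebraMap K _ r →
      grGen α₁ α₂ α₃ i * grGen α₁ α₂ α₃ j = algebraMap K _ 0 := by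
    intro i j r h
    have hs := (isSymbol_gen (α₁ := α₁) (α₂ := α₂) (α₃ := α₃) i).mul (isSymbol_gen j)
    rw [h] at hs
    rw [map_zero]
    exact hs.unique (isSymbol_scalar_succ 1 r)
  have hcyc : ∀ {i j k l m n r}, gen α₁ α₂ α₃ i * gen α₁ α₂ α₃ j +
      gen α₁ α₂ α₃ k * gen α₁ α₂ α₃ l + gen α₁ α₂ α₃ m * gen α₁ α₂ α₃ n = algebraMap K _ r →
      grGen α₁ α₂ α₃ i * grGen α₁ α₂ α₃ j + grGen α₁ α₂ α₃ k * grGen α₁ α₂ α₃ l +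
        grGen α₁ α₂ α₃ m * grGen α₁ α₂ α₃ n = algebraMap K _ 0 := by
    intro i j k l m n r h
    have hs := (((isSymbol_gen (α₁ := α₁) (α₂ := α₂) (α₃ := α₃) i).mul (isSymbol_gen j)).add
      ((isSymbol_gen k).mul (isSymbol_gen l))).add ((isSymbol_gen m).mul (isSymbol_gen n))
    rw [h] at hs
    rw [map_zero]
    exact hs.unique (isSymbol_scalar_succ 1 r)
  have h := quadRel α₁ α₂ α₃
  exact ⟨hsq h.aa, hsq h.bb, hsq h.cc, hsq h.dd, hcyc h.abc, hcyc h.acd, hcyc h.adb, hcyc h.bdc⟩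

theorem grGen_six : (grGen α₁ α₂ α₃ 0 + grGen α₁ α₂ α₃ 1 + grGen α₁ α₂ α₃ 2) ^ 6 = 0 := by
  have hs := isSymbol_cube (quadRel α₁ α₂ α₃) (isSymbol_gen 0) (isSymbol_gen 1) (isSymbol_gen 2)
  rw [cube] at hs
  exact hs.unique (isSymbol_scalar_succ 5 α₃)

variable (α₁ α₂ α₃) in
/-- The homomorphism from `B` to the associated graded algebra of `T(α₁, α₂, α₃)`, which exists
because the relations of `B` hold there. -/
def ofNichols : Nichols K →ₐ[K] ⨁ n, GrPiece (fil α₁ α₂ α₃) n :=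
  RingQuot.liftAlgHom K ⟨FreeAlgebra.lift K (grGen α₁ α₂ α₃),
    Nichols.lift_aux K grGen_quadRel grGen_six⟩

theorem ofNichols_gen (i : Fin 4) :
    ofNichols α₁ α₂ α₃ (Nichols.gen K i) = grGen α₁ α₂ α₃ i := by
  rw [ofNichols, Nichols.gen, RingQuot.liftAlgHom_mkAlgHom_apply, FreeAlgebra.lift_ι_apply]

/-- The homomorphism from `T(α₁, α₂, α₃)` given by four elements that satisfy its relations. -/
def lift {D : Type*} [Ring D] [Algebra K D] {x : Fin 4 → D}
    (h : QuadRel α₁ α₂ (x 0) (x 1) (x 2) (x 3))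
    (hc : (x 2 * x 1 + x 1 * x 0 + x 0 * x 2 - algebraMap K D α₂) ^ 3 = algebraMap K D α₃) :
    DefAlg α₁ α₂ α₃ →ₐ[K] D :=
  RingQuot.liftAlgHom K ⟨FreeAlgebra.lift K x, by
    intro y z hyz
    cases hyz <;> simp only [map_pow, map_sub, map_add, map_mul, AlgHom.commutes,
      FreeAlgebra.lift_ι_apply]
    exacts [h.aa, h.bb, h.cc, h.dd, h.abc, h.acd, h.adb, h.bdc, hc]⟩

theorem lift_gen {D : Type*} [Ring D] [Algebra K D] {x : Fin 4 → D}
    (h : QuadRel α₁ α₂ (x 0) (x 1) (x 2) (x 3))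
    (hc : (x 2 * x 1 + x 1 * x 0 + x 0 * x 2 - algebraMap K D α₂) ^ 3 = algebraMap K D α₃)
    (i : Fin 4) : lift h hc (gen α₁ α₂ α₃ i) = x i := by
  rw [lift, gen, RingQuot.liftAlgHom_mkAlgHom_apply, FreeAlgebra.lift_ι_apply]

section Compare

variable {D : Type*} [Ring D] [Algebra K D] {F : ℕ → Submodule K D}
  [IsRingFiltration F (lowerPart F)] {ψ : (⨁ n, GrPiece F n) ≃ₐ[K] Nichols K}
  {φ : DefAlg α₁ α₂ α₃ →ₐ[K] D}

/-- A class in the associated graded algebra of `T(α₁, α₂, α₃)` comes from an element of `B`, and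
this element is the symbol of its image in the deformation. -/
theorem exists_symbol (hφ : ∀ i, IsSymbol ψ 1 (φ (gen α₁ α₂ α₃ i)) (Nichols.gen K i)) {n : ℕ}
    {t : DefAlg α₁ α₂ α₃} (ht : t ∈ fil α₁ α₂ α₃ n) :
    ∃ b, IsSymbol (K := K) AlgEquiv.refl n t (ofNichols α₁ α₂ α₃ b) ∧ IsSymbol ψ n (φ t) b := by
  have hS : ∀ s ∈ Submodule.span K (Set.range (gen α₁ α₂ α₃)), ∃ b,
      IsSymbol (K := K) AlgEquiv.refl 1 s (ofNichols α₁ α₂ α₃ b) ∧ IsSymbol ψ 1 (φ s) b := by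
    intro s hs
    induction hs using Submodule.span_induction with
    | mem s hs =>
      obtain ⟨i, rfl⟩ := hs
      exact ⟨_, by rw [ofNichols_gen]; exact isSymbol_gen i, hφ i⟩
    | zero =>
      refine ⟨0, ?_, ?_⟩ <;> rw [map_zero, IsSymbol.zero_iff] <;> exact zero_mem _
    | add s t _ _ hs ht =>
      obtain ⟨b, hb, hb'⟩ := hs
      obtain ⟨c, hc, hc'⟩ := ht
      exact ⟨b + c, by rw [map_add]; exact hb.add hc, by rw [map_add]; exact hb'.add hc'⟩
    | smul r s _ hs =>
      obtain ⟨b, hb, hb'⟩ := hs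
      exact ⟨r • b, by rw [map_smul]; exact hb.smul r, by rw [map_smul]; exact hb'.smul r⟩
  induction n generalizing t with
  | zero =>
    rw [fil, pow_zero] at ht
    obtain ⟨r, rfl⟩ := Submodule.mem_one.1 ht
    refine ⟨algebraMap K _ r, ?_, ?_⟩ <;> rw [AlgHom.commutes] <;> exact IsSymbol.scalar r
  | succ n ih =>
    rw [fil, pow_succ] at ht
    induction ht using Submodule.mul_induction_on' with
    | mem_mul_mem t ht s hs =>
      obtain ⟨b, hb, hb'⟩ := ih ht
      obtain ⟨_, h1, s, hs', rfl⟩ := Submodule.mem_sup.1 hs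
      obtain ⟨r, rfl⟩ := Submodule.mem_one.1 h1
      obtain ⟨c, hc, hc'⟩ := hS s hs'
      have e : t * (algebraMap K _ r + s) = r • t + t * s := by
        rw [mul_add, ← Algebra.commutes, Algebra.smul_def]
      refine ⟨0 + b * c, ?_, ?_⟩
      · rw [e, map_add, map_zero, map_mul]
        refine IsSymbol.add (IsSymbol.zero_iff.2 ?_) (hb.mul hc)
        exact mem_lowerPart_of_isSymbol_lt n.lt_succ_self (hb.smul r)
      · rw [e, map_add, map_mul, map_smul]
        refine IsSymbol.add (IsSymbol.zero_iff.2 ?_) (hb'.mul hc')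
        exact mem_lowerPart_of_isSymbol_lt n.lt_succ_self (hb'.smul r)
    | add s _ t _ hs ht =>
      obtain ⟨b, hb, hb'⟩ := hs
      obtain ⟨c, hc, hc'⟩ := ht
      exact ⟨b + c, by rw [map_add]; exact hb.add hc, by rw [map_add]; exact hb'.add hc'⟩

/-- The symbol in `B` of an element of the kernel vanishes, so the element has lower degree. -/
theorem eq_zero_of_map_eq_zero
    (hφ : ∀ i, IsSymbol ψ 1 (φ (gen α₁ α₂ α₃ i)) (Nichols.gen K i)) {n : ℕ}
    {t : DefAlg α₁ α₂ α₃} (ht : t ∈ fil α₁ α₂ α₃ n) (h0 : φ t = 0) : t = 0 := by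
  have hlow : ∀ {n}, t ∈ fil α₁ α₂ α₃ n → t ∈ lowerPart (fil α₁ α₂ α₃) n := by
    intro n ht
    obtain ⟨b, hb, hb'⟩ := exists_symbol hφ ht
    rw [h0] at hb'
    rw [hb'.unique (IsSymbol.zero_iff.2 (zero_mem _)), map_zero, IsSymbol.zero_iff] at hb
    exact hb
  induction n with
  | zero => simpa [lowerPart_zero] using hlow ht
  | succ n ih => exact ih (by simpa only [lowerPart_succ] using hlow ht)

/-- Every element of `B` is the symbol of an element of the image, as `B` is generated in degree
one. -/
theorem exists_preimage_of_mem_piece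
    (hφ : ∀ i, IsSymbol ψ 1 (φ (gen α₁ α₂ α₃ i)) (Nichols.gen K i)) {n : ℕ}
    {b : Nichols K} (hb : b ∈ Nichols.piece K n) :
    ∃ t ∈ fil α₁ α₂ α₃ n, IsSymbol ψ n (φ t) b := by
  have hS : ∀ m ∈ Submodule.span K (Set.range (Nichols.gen K)),
      ∃ t ∈ fil α₁ α₂ α₃ 1, IsSymbol ψ 1 (φ t) m := by
    intro m hm
    induction hm using Submodule.span_induction with
    | mem m hm =>
      obtain ⟨i, rfl⟩ := hm
      exact ⟨_, gen_mem_fil i, hφ i⟩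
    | zero => exact ⟨0, zero_mem _, by rw [map_zero, IsSymbol.zero_iff]; exact zero_mem _⟩
    | add b c _ _ hb hc =>
      obtain ⟨s, hs, hs'⟩ := hb
      obtain ⟨t, ht, ht'⟩ := hc
      exact ⟨s + t, add_mem hs ht, by rw [map_add]; exact hs'.add ht'⟩
    | smul r b _ hb =>
      obtain ⟨s, hs, hs'⟩ := hb
      exact ⟨r • s, Submodule.smul_mem _ r hs, by rw [map_smul]; exact hs'.smul r⟩
  rw [Nichols.piece] at hb
  induction hb using Submodule.pow_induction_on_left' with
  | algebraMap r =>
    exact ⟨algebraMap K _ r, (IsSymbol.scalar (ψ := AlgEquiv.refl) r).mem, by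
      rw [AlgHom.commutes]; exact IsSymbol.scalar r⟩
  | add b c n _ _ hb hc =>
    obtain ⟨s, hs, hs'⟩ := hb
    obtain ⟨t, ht, ht'⟩ := hc
    exact ⟨s + t, add_mem hs ht, by rw [map_add]; exact hs'.add ht'⟩
  | mem_mul m hm n b _ hb =>
    obtain ⟨s, hs, hs'⟩ := hS m hm
    obtain ⟨t, ht, ht'⟩ := hb
    rw [Nat.succ_eq_add_one, add_comm]
    exact ⟨s * t, SetLike.mul_mem_graded hs ht, by rw [map_mul]; exact hs'.mul ht'⟩

theorem map_fil
    (hψ : ∀ n, (LinearMap.range (DirectSum.lof K ℕ (GrPiece F) n)).map ψ.toLinearMap =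
      Nichols.piece K n)
    (hφ : ∀ i, IsSymbol ψ 1 (φ (gen α₁ α₂ α₃ i)) (Nichols.gen K i)) (n : ℕ) :
    (fil α₁ α₂ α₃ n).map φ.toLinearMap = F n := by
  refine le_antisymm ?_ ?_
  · rintro _ ⟨t, ht, rfl⟩
    obtain ⟨b, -, hb⟩ := exists_symbol hφ ht
    exact hb.mem
  · have step : ∀ n, lowerPart F n ≤ (fil α₁ α₂ α₃ n).map φ.toLinearMap →
        F n ≤ (fil α₁ α₂ α₃ n).map φ.toLinearMap := by
      intro n hn z hz
      obtain ⟨b, hb⟩ := IsSymbol.exists_of_mem ψ hz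
      obtain ⟨t, ht, ht'⟩ := exists_preimage_of_mem_piece hφ (hb.mem_graded hψ)
      have h := hb.sub ht'
      rw [sub_self, IsSymbol.zero_iff] at h
      have := add_mem (hn h) (Submodule.mem_map_of_mem (f := φ.toLinearMap) ht)
      rwa [AlgHom.toLinearMap_apply, sub_add_cancel] at this
    induction n with
    | zero => exact step 0 (by rw [lowerPart_zero]; exact bot_le)
    | succ n ih =>
      refine step _ ?_
      rw [lowerPart_succ]
      exact ih.trans (Submodule.map_mono (fil_monotone α₁ α₂ α₃ n.le_succ))

end Compare

theorem exists_mem_fil (t : DefAlg α₁ α₂ α₃) : ∃ n, t ∈ fil α₁ α₂ α₃ n := by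
  have ht : t ∈ Algebra.adjoin K (Set.range (gen α₁ α₂ α₃)) := by
    rw [adjoin_gen]; trivial
  induction ht using Algebra.adjoin_induction with
  | mem x hx => obtain ⟨i, rfl⟩ := hx; exact ⟨1, gen_mem_fil i⟩
  | algebraMap r => exact ⟨0, (IsSymbol.scalar (ψ := AlgEquiv.refl) r).mem⟩
  | add x y _ _ hx hy =>
    obtain ⟨m, hm⟩ := hx
    obtain ⟨n, hn⟩ := hy
    exact ⟨max m n, add_mem (fil_monotone α₁ α₂ α₃ (le_max_left m n) hm)
      (fil_monotone α₁ α₂ α₃ (le_max_right m n) hn)⟩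
  | mul x y _ _ hx hy =>
    obtain ⟨m, hm⟩ := hx
    obtain ⟨n, hn⟩ := hy
    exact ⟨m + n, SetLike.mul_mem_graded hm hn⟩

theorem map_act_of_map_gen {D : Type*} [Ring D] [Algebra K D] {φ : DefAlg α₁ α₂ α₃ →ₐ[K] D}
    {σ : EnvGroup →* (D ≃ₐ[K] D)} {x : Fin 4 → D} (hφ : ∀ i, φ (gen α₁ α₂ α₃ i) = x i)
    (hσ : ∀ i j, σ (g i) (x j) = - x (op i j)) (γ : EnvGroup) (t : DefAlg α₁ α₂ α₃) :
    φ (act α₁ α₂ α₃ γ t) = σ γ (φ t) := by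
  induction γ using PresentedGroup.induction_on with
  | _ w =>
  induction w using FreeGroup.induction_on generalizing t with
  | C1 => simp only [map_one, AlgEquiv.one_apply]
  | of i =>
    have : φ.comp (act α₁ α₂ α₃ (g i)).toAlgHom = (σ (g i)).toAlgHom.comp φ :=
      AlgHom.ext_of_adjoin_eq_top (adjoin_gen α₁ α₂ α₃) <| by
        rintro _ ⟨j, rfl⟩
        change φ (act α₁ α₂ α₃ (g i) (gen α₁ α₂ α₃ j)) = σ (g i) (φ (gen α₁ α₂ α₃ j))
        rw [act_of_gen, hφ, hσ, map_neg, hφ]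
    exact DFunLike.congr_fun this t
  | inv_of i hi =>
    rw [map_inv, map_inv, map_inv, AlgEquiv.aut_inv, AlgEquiv.aut_inv, AlgEquiv.eq_symm_apply,
      ← hi, AlgEquiv.apply_symm_apply]
  | mul v w hv hw =>
    simp only [map_mul, AlgEquiv.mul_apply]
    rw [hv, hw]

end DefAlg

end Tetrahedron

theorem mainTheorem6 {K : Type*} [Field K] [IsAlgClosed K] (h2 : (2 : K) ≠ 0) (h3 : (3 : K) ≠ 0)
    {D : Type*} [Ring D] [Algebra K D] (𝓓 : FilteredGAlgebra K Tetrahedron.EnvGroup D)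
    (hD : IsPBWDeformation (Tetrahedron.Nichols.piece K) (Tetrahedron.Nichols.act K) 𝓓) :
    ∃ α₁ α₂ α₃ : K, ∃ φ : Tetrahedron.DefAlg α₁ α₂ α₃ ≃ₐ[K] D,
      (∀ (g : Tetrahedron.EnvGroup) (t : Tetrahedron.DefAlg α₁ α₂ α₃),
        φ (Tetrahedron.DefAlg.act α₁ α₂ α₃ g t) = 𝓓.act g (φ t)) ∧
      ∀ n : ℕ, (Tetrahedron.DefAlg.fil α₁ α₂ α₃ n).map φ.toLinearMap = 𝓓.fil n := by
  obtain ⟨ψ, hψ, hρ⟩ := hD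
  obtain ⟨x, hx, hact⟩ := Tetrahedron.exists_lift h2 hψ hρ
  obtain ⟨α₁, α₂, hq⟩ := Tetrahedron.exists_quadRel h2 hψ hρ hx hact
  obtain ⟨α₃, hc⟩ := Tetrahedron.exists_cube h2 h3 hψ hρ hx hact hq
  have hgen := Tetrahedron.DefAlg.lift_gen hq hc
  have hφ : ∀ i, IsSymbol ψ 1 (Tetrahedron.DefAlg.lift hq hc (Tetrahedron.DefAlg.gen α₁ α₂ α₃ i))
      (Tetrahedron.Nichols.gen K i) := fun i => by rw [hgen]; exact hx i
  have hfil := Tetrahedron.DefAlg.map_fil hψ hφ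
  have hbij : Function.Bijective (Tetrahedron.DefAlg.lift hq hc) := by
    refine ⟨(injective_iff_map_eq_zero _).2 fun t ht => ?_, fun z => ?_⟩
    · obtain ⟨n, hn⟩ := Tetrahedron.DefAlg.exists_mem_fil t
      exact Tetrahedron.DefAlg.eq_zero_of_map_eq_zero hφ hn ht
    · obtain ⟨n, hn⟩ := 𝓓.exhaustive z
      rw [← hfil n] at hn
      obtain ⟨t, -, ht⟩ := hn
      exact ⟨t, ht⟩
  exact ⟨α₁, α₂, α₃, AlgEquiv.ofBijective _ hbij,
    Tetrahedron.DefAlg.map_act_of_map_gen hgen hact, hfil⟩
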